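/- Let $(\Omega,d)$ be a metric space with its Borel $\sigma$-algebra, $\nu$ a Borel probability measure on $\Omega$, $T:\Omega\to\Omega$ a measurable $\nu$-preserving transformation, $\eta\in(0,1]$ and $r_0\ge 1$. For a bounded $\eta$-Hölder continuous $f:\Omega\to\mathbf C$ write $\|f\|_\infty=\sup_x|f(x)|$ and $C_f^{(\eta)}=\sup_{x\ne y}|f(x)-f(y)|/d(x,y)^\eta$; write $\mathrm{Cov}_\nu(f,g)=\mathbf E_\nu[fg]-\mathbf E_\nu[f]\mathbf E_\nu[g]$. Assume that $(\Omega,\nu,T)$ satisfies the multiple decorrelation property $(\mathcal P_{r_0})$: there exist a polynomial $P$ with nonnegative real coefficients and $\delta\in(0,1)$ such that, for all integers $m,m'\ge1$, all bounded $\eta$-Hölder continuous $f_1,\dots,f_{m+m'}:\Omega\to\mathbf C$, all strictly increasing sequences of nonnegative integers $k_1<\dots<k_m$ and $l_1<\dots<l_{m'}$, and all integers $n\ge0$, $$\Bigl|\mathrm{Cov}_\nu\Bigl(\prod_{i=1}^m f_i\circ T^{k_i},\ \prod_{j=1}^{m'} f_{m+j}\circ T^{n+l_j}\Bigr)\Bigr|\le\Bigl(\prod_{i=1}^{m+m'}\|f_i\|_\infty+\sum_{i=1}^{m+m'}C_{f_i}^{(\eta)}\prod_{j\ne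 i}\|f_j\|_\infty\Bigr)P(l_{m'})\,\delta^{\,n-r_0k_m}.$$ Endow $\mathbf R^d$ with the norm $|x|_\infty=\max_i|x_i|$, and let $F:\mathbf R^d\times\Omega\to\mathbf R^d$ be measurable, uniformly bounded, uniformly Lipschitz continuous in the first variable, and uniformly $\eta$-Hölder continuous in the second variable. For $\varepsilon>0$, $x\in\mathbf R^d$, $\omega\in\Omega$, let $t\mapsto x_t^\varepsilon(x,\omega)$, $t\ge0$, be the continuous solution of $$x_0^\varepsilon(x,\omega)=x,\qquad \frac{dx_t^\varepsilon}{dt}(x,\omega)=F\bigl(x_t^\varepsilon(x,\omega),T^{\lfloor t/\varepsilon\rfloor}(\omega)\bigr)\quad(t\ge 0,\ t\notin\varepsilon\mathbf Z),$$ let $t\mapsto w_t(x)$, $t\ge0$, be the solution of $$w_0(x)=x,\qquad \frac{dw_t}{dt}(x)=\int_\Omega F(w_t(x),\omega')\,d\nu(\omega'),$$ and put $e_t^\varepsilon(x,\omega)=x_t^\varepsilon(x,\omega)-w_t(x)$. Let $T_0>0$. Then, for all $\varepsilon>0$ and $x\in\mathbf R^d$, the function $\omega\mapsto\sup_{t\in[0,T_0]}|e_t^\varepsilon(x,\omega)|_\infty$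 is measurable, and for every real $p\ge1$, $$\sup_{x\in\mathbf R^d}\Bigl\|\sup_{t\in[0,T_0]}|e_t^\varepsilon(x,\cdot)|_\infty\Bigr\|_{L^{2p}(\nu)}=O(\sqrt\varepsilon)\qquad(\varepsilon\to0^+).$$ -/

import Mathlib

open MeasureTheory Filter Topology Set
open scoped NNReal ENNReal

namespace Averaging

/-! ### Multiple decorrelation -/

section Decorrelation

variable {Ω : Type*}

/-- The supremum norm `‖f‖_∞ = sup_x |f x|` of a bounded complex-valued function. -/
noncomputable def supNorm (f : Ω → ℂ) : ℝ := ⨆ x : Ω, ‖f x‖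

/-- The Hölder coefficient `sup_{x ≠ y} |f x - f y| / d(x, y) ^ η`. -/
noncomputable def holderCoeff [MetricSpace Ω] (η : ℝ) (f : Ω → ℂ) : ℝ :=
  ⨆ q : {q : Ω × Ω // q.1 ≠ q.2}, ‖f q.1.1 - f q.1.2‖ / dist q.1.1 q.1.2 ^ η

/-- `f` is bounded and `η`-Hölder continuous. -/
def IsBoundedHolder [MetricSpace Ω] (η : ℝ) (f : Ω → ℂ) : Prop :=
  (∃ M : ℝ, ∀ x, ‖f x‖ ≤ M) ∧ ∃ C : ℝ, ∀ x y, ‖f x - f y‖ ≤ C * dist x y ^ η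

/-- The covariance `E[f g] - E[f] E[g]` (without complex conjugation). -/
noncomputable def cov [MeasurableSpace Ω] (ν : Measure Ω) (f g : Ω → ℂ) : ℂ :=
  (∫ ω, f ω * g ω ∂ν) - (∫ ω, f ω ∂ν) * ∫ ω, g ω ∂ν

/-- The multiple decorrelation property with parameter `r`, for bounded `η`-Hölder observables.
The two (nonempty) groups of observables are indexed by the two summands of
`Fin (m + 1) ⊕ Fin (m' + 1)`; the largest times of the groups are `k (Fin.last m)` and
`l (Fin.last m')`. -/
def MultipleDecorrelation [MetricSpace Ω] [MeasurableSpace Ω]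
    (ν : Measure Ω) (T : Ω → Ω) (η r : ℝ) : Prop :=
  ∃ (P : Polynomial ℝ) (δ : ℝ), (∀ i, 0 ≤ P.coeff i) ∧ 0 < δ ∧ δ < 1 ∧
    ∀ (m m' : ℕ) (f : Fin (m + 1) ⊕ Fin (m' + 1) → Ω → ℂ), (∀ i, IsBoundedHolder η (f i)) →
    ∀ (k : Fin (m + 1) → ℕ) (l : Fin (m' + 1) → ℕ), StrictMono k → StrictMono l → ∀ n : ℕ,
      ‖cov ν (fun ω => ∏ i, f (Sum.inl i) (T^[k i] ω))
          (fun ω => ∏ j, f (Sum.inr j) (T^[n + l j] ω))‖ ≤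
        ((∏ i, supNorm (f i)) +
            ∑ i, holderCoeff η (f i) * ∏ j ∈ Finset.univ.erase i, supNorm (f j)) *
          P.eval (l (Fin.last m') : ℝ) * δ ^ ((n : ℝ) - r * (k (Fin.last m) : ℝ))

end Decorrelation

/-! ### The perturbed and the averaged differential equation

Vectors of `ℝ^d` are elements of `Fin d → ℝ`, whose norm is the supremum norm `|·|_∞`. -/

section ODE

variable {Ω : Type*} {d : ℕ}

/-- The averaged vector field `x ↦ ∫ F(x, ω) dν(ω)`. -/
noncomputable def averagedField [MeasurableSpace Ω] (ν : Measure Ω)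
    (F : (Fin d → ℝ) → Ω → (Fin d → ℝ)) (x : Fin d → ℝ) : Fin d → ℝ :=
  ∫ ω, F x ω ∂ν

/-- `y` is, on `[0, ∞)`, a continuous solution of `dy/dt = F(y, T^⌊t/ε⌋ ω)` for
`t ∉ {0, ε, 2ε, …}`, with `y 0 = x`. -/
structure IsPerturbedSolution (T : Ω → Ω) (F : (Fin d → ℝ) → Ω → (Fin d → ℝ)) (ε : ℝ)
    (x : Fin d → ℝ) (ω : Ω) (y : ℝ → Fin d → ℝ) : Prop where
  initial : y 0 = x
  continuousOn : ContinuousOn y (Ici 0)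
  hasDerivAt : ∀ t : ℝ, 0 ≤ t → (∀ k : ℕ, t ≠ ε * k) →
    HasDerivAt y (F (y t) (T^[⌊t / ε⌋₊] ω)) t

/-- `w` is, on `[0, ∞)`, a solution of the averaged equation with `w 0 = x`. -/
structure IsAveragedSolution [MeasurableSpace Ω] (ν : Measure Ω)
    (F : (Fin d → ℝ) → Ω → (Fin d → ℝ)) (x : Fin d → ℝ) (w : ℝ → Fin d → ℝ) : Prop where
  initial : w 0 = x
  hasDerivWithinAt : ∀ t : ℝ, 0 ≤ t →
    HasDerivWithinAt w (averagedField ν F (w t)) (Ici 0) t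

/-- The solution `t ↦ x_t^ε(x, ω)` of the perturbed equation. For `F` bounded and Lipschitz in its
first variable it exists (see `exists_isPerturbedSolution`), and its values at the times `t ≥ 0`
are unique by Gronwall's lemma. -/
noncomputable def perturbedSolution (T : Ω → Ω) (F : (Fin d → ℝ) → Ω → (Fin d → ℝ)) (ε : ℝ)
    (x : Fin d → ℝ) (ω : Ω) : ℝ → Fin d → ℝ :=
  Classical.epsilon (IsPerturbedSolution T F ε x ω)

/-- The solution `t ↦ w_t(x)` of the averaged equation. For `F` measurable, bounded and Lipschitz
in its first variable it exists (see `exists_isAveragedSolution`), and its values at the times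
`t ≥ 0` are unique by Gronwall's lemma. -/
noncomputable def averagedSolution [MeasurableSpace Ω] (ν : Measure Ω)
    (F : (Fin d → ℝ) → Ω → (Fin d → ℝ)) (x : Fin d → ℝ) : ℝ → Fin d → ℝ :=
  Classical.epsilon (IsAveragedSolution ν F x)

/-- The error term `e_t^ε(x, ω) = x_t^ε(x, ω) - w_t(x)`. -/
noncomputable def errorTerm [MeasurableSpace Ω] (ν : Measure Ω) (T : Ω → Ω)
    (F : (Fin d → ℝ) → Ω → (Fin d → ℝ)) (ε t : ℝ) (x : Fin d → ℝ) (ω : Ω) : Fin d → ℝ :=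
  perturbedSolution T F ε x ω t - averagedSolution ν F x t

/-- The maximal error `sup_{t ∈ [0, T₀]} |e_t^ε(x, ω)|_∞`, as an element of `[0, ∞]`. -/
noncomputable def maxError [MeasurableSpace Ω] (ν : Measure Ω) (T : Ω → Ω)
    (F : (Fin d → ℝ) → Ω → (Fin d → ℝ)) (T₀ ε : ℝ) (x : Fin d → ℝ) (ω : Ω) : ℝ≥0∞ :=
  ⨆ t ∈ Icc (0 : ℝ) T₀, ‖errorTerm ν T F ε t x ω‖ₑ

end ODE

/-! ### Existence of the solutions -/

section Existence

variable {d : ℕ}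

theorem exists_step {G : (Fin d → ℝ) → (Fin d → ℝ)} {K M : ℝ≥0} (hK : LipschitzWith K G)
    (hM : ∀ x, ‖G x‖ ≤ M) (a h : ℝ) (hh : 0 ≤ h) (x : Fin d → ℝ) :
    ∃ y : ℝ → Fin d → ℝ, y a = x ∧
      ∀ t ∈ Icc a (a + h), HasDerivWithinAt y (G (y t)) (Icc a (a + h)) t := by
  have hpl : IsPicardLindelof (fun _ : ℝ => G) (tmin := a) (tmax := a + h)
      ⟨a, left_mem_Icc.2 (by linarith)⟩ x (M * h.toNNReal) 0 M K := by
    refine ⟨fun t _ => hK.lipschitzOnWith, fun x _ => continuousOn_const, fun t _ x _ => hM x, ?_⟩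
    simp [hh]
  exact hpl.exists_eq_forall_mem_Icc_hasDerivWithinAt₀

theorem exists_glued {G : ℕ → (Fin d → ℝ) → (Fin d → ℝ)} {K M : ℝ≥0}
    (hK : ∀ k, LipschitzWith K (G k)) (hM : ∀ k x, ‖G k x‖ ≤ M) {ε : ℝ} (hε : 0 < ε)
    (x : Fin d → ℝ) :
    ∃ y : ℝ → Fin d → ℝ, y 0 = x ∧ ∀ k : ℕ, ∀ t ∈ Icc (ε * k) (ε * k + ε),
      HasDerivWithinAt y (G k (y t)) (Icc (ε * k) (ε * k + ε)) t := by
  choose φ hφ0 hφ using fun (k : ℕ) (z : Fin d → ℝ) =>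
    exists_step (hK k) (hM k) (ε * k) ε hε.le z
  let z : ℕ → Fin d → ℝ := fun k => Nat.rec x (fun k zk => φ k zk (ε * k + ε)) k
  have hz : ∀ k, z (k + 1) = φ k (z k) (ε * k + ε) := fun k => rfl
  let y : ℝ → Fin d → ℝ := fun t => φ ⌊t / ε⌋₊ (z ⌊t / ε⌋₊) t
  have hgrid : ∀ k : ℕ, y (ε * k) = z k := by
    intro k
    have : ⌊ε * k / ε⌋₊ = k := by rw [mul_div_cancel_left₀ _ hε.ne', Nat.floor_natCast]
    simp only [y, this, hφ0]
  have hy : ∀ k : ℕ, ∀ t ∈ Icc (ε * k) (ε * k + ε), y t = φ k (z k) t := by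
    intro k t ht
    rcases ht.2.eq_or_lt with h | h
    · have := hgrid (k + 1)
      push_cast at this
      rw [h, show ε * k + ε = ε * (k + 1) by ring, this, hz]
      ring_nf
    · have : ⌊t / ε⌋₊ = k := by
        rw [Nat.floor_eq_iff (div_nonneg (le_trans (by positivity) ht.1) hε.le)]
        constructor
        · rw [le_div_iff₀ hε]; linarith [ht.1]
        · rw [div_lt_iff₀ hε]; linarith
      simp only [y, this]
  refine ⟨y, by simpa [z] using hgrid 0, fun k t ht => ?_⟩
  rw [hy k t ht]
  exact (hφ k (z k) t ht).congr (hy k) (hy k t ht)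

/-- Every time `t ≥ 0` is `0`, lies inside a cell of the grid, or is a later grid point. -/
theorem grid_cases {ε : ℝ} (hε : 0 < ε) {t : ℝ} (ht : 0 ≤ t) :
    t ∈ Ioo (ε * (⌊t / ε⌋₊ : ℕ)) (ε * (⌊t / ε⌋₊ : ℕ) + ε) ∨ t = 0 ∨
      ∃ k : ℕ, t = ε * k + ε := by
  have h0 : (0 : ℝ) ≤ t / ε := div_nonneg ht hε.le
  have h1 := Nat.floor_le h0
  have h2 := Nat.lt_floor_add_one (t / ε)
  rw [le_div_iff₀ hε] at h1
  rw [div_lt_iff₀ hε] at h2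
  rcases h1.eq_or_lt with h | h
  · right
    rcases hk : ⌊t / ε⌋₊ with _ | k
    · left; rw [hk] at h; simpa using h.symm
    · right; rw [hk] at h; exact ⟨k, by push_cast at h; linarith⟩
  · left; exact ⟨by linarith, by linarith⟩

theorem exists_isPerturbedSolution {Ω : Type*} (T : Ω → Ω)
    {F : (Fin d → ℝ) → Ω → (Fin d → ℝ)} {K M : ℝ≥0}
    (hK : ∀ ω, LipschitzWith K fun x => F x ω) (hM : ∀ x ω, ‖F x ω‖ ≤ M)
    {ε : ℝ} (hε : 0 < ε) (x : Fin d → ℝ) (ω : Ω) :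
    ∃ y, IsPerturbedSolution T F ε x ω y := by
  obtain ⟨y, hy0, hy⟩ := exists_glued (G := fun k x => F x (T^[k] ω)) (fun k => hK _)
    (fun k x => hM x _) hε x
  refine ⟨y, hy0, fun t ht => ?_, fun t ht hne => ?_⟩
  · rcases grid_cases hε ht with h | rfl | ⟨k, rfl⟩
    · exact ((hy _ t (Ioo_subset_Icc_self h)).hasDerivAt
        (Icc_mem_nhds h.1 h.2)).continuousAt.continuousWithinAt
    · have := (hy 0 0 (by simp [hε.le])).continuousWithinAt
      refine this.mono_of_mem_nhdsWithin ?_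
      simpa using Icc_mem_nhdsGE hε
    · have h1 := (hy k (ε * k + ε) ⟨by linarith, le_rfl⟩).continuousWithinAt
      have h2 := (hy (k + 1) (ε * k + ε)
        ⟨by push_cast; linarith, by push_cast; linarith⟩).continuousWithinAt
      refine ((h1.union h2).continuousAt ?_).continuousWithinAt
      push_cast
      rw [show ε * (k + 1) = ε * k + ε by ring,
        Icc_union_Icc_eq_Icc (by linarith) (by linarith)]
      exact Icc_mem_nhds (by linarith) (by linarith)
  · rcases grid_cases hε ht with h | rfl | ⟨k, rfl⟩
    · exact (hy _ t (Ioo_subset_Icc_self h)).hasDerivAt (Icc_mem_nhds h.1 h.2)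
    · exact absurd (by simp) (hne 0)
    · exact absurd (by push_cast; ring) (hne (k + 1))

theorem exists_isAveragedSolution {Ω : Type*} [MeasurableSpace Ω] (ν : Measure Ω)
    [IsProbabilityMeasure ν] {F : (Fin d → ℝ) → Ω → (Fin d → ℝ)} {K M : ℝ≥0}
    (hmeas : Measurable (Function.uncurry F))
    (hK : ∀ ω, LipschitzWith K fun x => F x ω) (hM : ∀ x ω, ‖F x ω‖ ≤ M) (x : Fin d → ℝ) :
    ∃ w, IsAveragedSolution ν F x w := by
  have hint : ∀ x, Integrable (F x) ν := fun x =>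
    Integrable.of_bound (hmeas.comp measurable_prodMk_left).aestronglyMeasurable M
      (ae_of_all _ (hM x))
  have hK' : LipschitzWith K (averagedField ν F) := by
    refine LipschitzWith.of_dist_le_mul fun a b => ?_
    rw [dist_eq_norm, averagedField, averagedField, ← integral_sub (hint a) (hint b)]
    refine (norm_integral_le_of_norm_le_const (C := K * dist a b) (ae_of_all _ fun ω => ?_)).trans
      (by simp)
    rw [← dist_eq_norm]
    exact (hK ω).dist_le_mul a b
  have hM' : ∀ x, ‖averagedField ν F x‖ ≤ M := fun x =>
    (norm_integral_le_of_norm_le_const (ae_of_all _ (hM x))).trans (by simp)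
  obtain ⟨w, hw0, hw⟩ := exists_glued (G := fun _ => averagedField ν F) (fun _ => hK')
    (fun _ => hM') one_pos x
  refine ⟨w, hw0, fun t ht => ?_⟩
  rcases grid_cases one_pos ht with h | rfl | ⟨k, rfl⟩
  · exact ((hw _ t (Ioo_subset_Icc_self h)).hasDerivAt (Icc_mem_nhds h.1 h.2)).hasDerivWithinAt
  · have := hw 0 0 (by simp)
    refine this.mono_of_mem_nhdsWithin ?_
    simpa using Icc_mem_nhdsGE (one_pos : (0 : ℝ) < 1)
  · have h1 := hw k (1 * k + 1) ⟨by linarith, le_rfl⟩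
    have h2 := hw (k + 1) (1 * k + 1) ⟨by push_cast; linarith, by push_cast; linarith⟩
    refine ((h1.union h2).hasDerivAt ?_).hasDerivWithinAt
    push_cast
    rw [show (1 : ℝ) * (k + 1) = 1 * k + 1 by ring,
      Icc_union_Icc_eq_Icc (by linarith) (by linarith)]
    exact Icc_mem_nhds (by linarith) (by linarith)

end Existence

end Averaging

namespace Averaging

/-! On the grid of step ε, both `x^ε` and `w` follow Euler recursions up to an error of order ε² per
step. When they are compared through the same Lipschitz maps `F(·, T^j ω)`, the only other
discrepancy at step `j` is ε times `f_j(T^j ω)`, where `f_j = F(w_{εj}, ·) - ∫ F(w_{εj}, ·) dν`. A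
discrete Gronwall argument, which keeps the cancellation inside the partial sums, bounds the maximal
error by O(ε) plus O(ε) times the maximum over `k ≤ T₀/ε` of `|∑_{j<k} f_j ∘ T^j|` (`maxError_le`).
Since `w` is deterministic, the `f_j` are centered observables with uniform sup and Hölder bounds.
It remains to show that the maximal partial sum up to `N ≈ T₀/ε` has order `√N` in `L^{2q}`.

For the moments, the `m`-th power of a partial sum is expanded into correlations over `m`-tuples of
times. If the times spread over a length `D`, a geometric-series argument (`exists_large_gap`) finds
a place to cut them in two groups such that the second starts at distance `v` and the first has
length at most `w`, with `v - r w ≥ c D`. Multiple decorrelation at this cut replaces the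
correlation by a product of two correlations of lower order, with an error exponentially small in
`D`. By induction on `m`, the products sum to `O(N^{m/2})`. The errors sum to `O(N)`, which suffices
for `m ≥ 2`, and the case `m = 1` vanishes by centering (`exists_sum_norm_integral_prod_le`).

A dyadic chaining passes from partial sums to their maximum without a logarithmic loss: each
doubling of the length multiplies the `L^r` norm of a maximum of two blocks by `2^{1/r}`, which is
less than `√2` when `r > 2` (`eLpNorm_dyadicMax_le`). Working in `L^{2q}` with an integer `q ≥ 2`,
`q ≥ p`, covers all exponents. -/

theorem supNorm_nonneg {Ω : Type*} (f : Ω → ℂ) : 0 ≤ supNorm f :=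
  Real.iSup_nonneg fun _ => norm_nonneg _

/-! ### Bounded Hölder observables and their products -/

section Holder

variable {Ω : Type*} [MetricSpace Ω] {η : ℝ}

/-- `f` is bounded by `1` and `η`-Hölder continuous with constant `c`. -/
structure UnitHolder (η c : ℝ) (f : Ω → ℂ) : Prop where
  norm_le : ∀ x, ‖f x‖ ≤ 1
  norm_sub_le : ∀ x y, ‖f x - f y‖ ≤ c * dist x y ^ η

theorem UnitHolder.continuous {c : ℝ} {f : Ω → ℂ} (hf : UnitHolder η c f) (hη : 0 < η) :
    Continuous f := by
  refine continuous_iff_continuousAt.2 fun x => tendsto_iff_norm_sub_tendsto_zero.2 ?_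
  refine squeeze_zero (fun y => norm_nonneg _) (fun y => hf.norm_sub_le y x) ?_
  have h : ContinuousAt (fun y => c * dist y x ^ η) x := by
    refine continuousAt_const.mul (ContinuousAt.rpow_const ?_ (Or.inr hη.le))
    exact (continuous_id.dist continuous_const).continuousAt
  simpa [ContinuousAt, Real.zero_rpow hη.ne'] using h

theorem UnitHolder.isBoundedHolder {c : ℝ} {f : Ω → ℂ} (hf : UnitHolder η c f) :
    IsBoundedHolder η f :=
  ⟨⟨1, hf.norm_le⟩, c, hf.norm_sub_le⟩

theorem UnitHolder.mono {c c' : ℝ} {f : Ω → ℂ} (hf : UnitHolder η c f) (h : c ≤ c') :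
    UnitHolder η c' f :=
  ⟨hf.norm_le, fun x y => (hf.norm_sub_le x y).trans (by gcongr)⟩

theorem UnitHolder.prod {ι : Type*} {f : ι → Ω → ℂ} (s : Finset ι)
    (hf : ∀ a ∈ s, UnitHolder η 1 (f a)) :
    UnitHolder η s.card (fun ω => ∏ a ∈ s, f a ω) := by
  classical
  induction s using Finset.induction_on with
  | empty => exact ⟨by simp, by simp⟩
  | insert a s ha ih =>
    have ih' := ih fun b hb => hf b (Finset.mem_insert_of_mem hb)
    have h1 := hf a (Finset.mem_insert_self a s)
    simp only [Finset.prod_insert ha, Finset.card_insert_of_notMem ha]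
    refine ⟨fun x => ?_, fun x y => ?_⟩
    · rw [norm_mul]
      exact mul_le_one₀ (h1.norm_le x) (norm_nonneg _) (ih'.norm_le x)
    · have hs : f a x * ∏ b ∈ s, f b x - f a y * ∏ b ∈ s, f b y =
          f a x * (∏ b ∈ s, f b x - ∏ b ∈ s, f b y) + (f a x - f a y) * ∏ b ∈ s, f b y := by ring
      rw [hs]
      refine (norm_add_le _ _).trans ?_
      rw [norm_mul, norm_mul]
      have e1 := mul_le_mul (h1.norm_le x) (ih'.norm_sub_le x y) (norm_nonneg _) zero_le_one
      have e2 := mul_le_mul (h1.norm_sub_le x y) (ih'.norm_le y) (norm_nonneg _)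
        (by positivity)
      push_cast
      linarith

theorem UnitHolder.supNorm_le {c : ℝ} {f : Ω → ℂ} (hf : UnitHolder η c f) : supNorm f ≤ 1 :=
  Real.iSup_le hf.norm_le zero_le_one

theorem holderCoeff_nonneg (f : Ω → ℂ) : 0 ≤ holderCoeff η f :=
  Real.iSup_nonneg fun _ => by positivity

theorem UnitHolder.holderCoeff_le {c : ℝ} (hc : 0 ≤ c) {f : Ω → ℂ} (hf : UnitHolder η c f) :
    holderCoeff η f ≤ c := by
  refine Real.iSup_le (fun q => ?_) hc
  have := dist_pos.2 q.2
  rw [div_le_iff₀ (by positivity)]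
  exact hf.norm_sub_le _ _

/-- This controls the prefactor in `MultipleDecorrelation` by the number of observables and their
common Hölder constant. -/
theorem UnitHolder.sum_prod_le {ι : Type*} [Fintype ι] [DecidableEq ι] {c : ℝ} (hc : 0 ≤ c)
    {f : ι → Ω → ℂ} (hf : ∀ i, UnitHolder η c (f i)) :
    (∏ i, supNorm (f i)) + ∑ i, holderCoeff η (f i) * ∏ j ∈ Finset.univ.erase i, supNorm (f j) ≤
      1 + Fintype.card ι * c := by
  have h (s : Finset ι) : ∏ j ∈ s, supNorm (f j) ≤ 1 :=
    Finset.prod_le_one (fun _ _ => supNorm_nonneg _) fun j _ => (hf j).supNorm_le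
  refine add_le_add (h _) ?_
  refine (Finset.sum_le_card_nsmul _ _ c fun i _ => ?_).trans (by simp)
  exact (mul_le_of_le_one_right (holderCoeff_nonneg _) (h _)).trans ((hf i).holderCoeff_le hc)

/-- Observables at possibly repeated times, written as observables at strictly increasing times. -/
theorem exists_strictMono_prod_eq {ι : Type*} {f : ι → Ω → ℂ} (hf : ∀ a, UnitHolder η 1 (f a))
    {A : Finset ι} (hA : A.Nonempty) (T : Ω → Ω) {i : ι → ℕ} {K : ℕ} (hi : ∀ a ∈ A, i a ≤ K) :
    ∃ (m : ℕ) (k : Fin (m + 1) → ℕ) (g : Fin (m + 1) → Ω → ℂ), m + 1 ≤ A.card ∧ StrictMono k ∧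
      k (Fin.last m) ≤ K ∧ (∀ j, UnitHolder η A.card (g j)) ∧
      ∀ ω, ∏ j, g j (T^[k j] ω) = ∏ a ∈ A, f a (T^[i a] ω) := by
  classical
  obtain ⟨m, hm⟩ : ∃ m, (A.image i).card = m + 1 :=
    Nat.exists_eq_succ_of_ne_zero (Finset.card_pos.2 (hA.image i)).ne'
  -- The times are the distinct values of `i` in increasing order. All observables sharing a time
  -- are fused into one product, whose Hölder constant is at most the number of its factors.
  refine ⟨m, (A.image i).orderEmbOfFin hm,
    fun j ω => ∏ a ∈ A.filter (i · = (A.image i).orderEmbOfFin hm j), f a ω,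
    hm ▸ Finset.card_image_le, OrderEmbedding.strictMono _, ?_, fun j => ?_, fun ω => ?_⟩
  · obtain ⟨a, ha, hak⟩ := Finset.mem_image.1 ((A.image i).orderEmbOfFin_mem hm (Fin.last m))
    exact hak ▸ hi a ha
  · refine (UnitHolder.prod _ fun a _ => hf a).mono ?_
    exact_mod_cast Finset.card_filter_le _ _
  · have h1 : ∀ t, ∏ a ∈ A.filter (i · = t), f a (T^[t] ω) =
        ∏ a ∈ A.filter (i · = t), f a (T^[i a] ω) := fun t =>
      Finset.prod_congr rfl fun a ha => by rw [(Finset.mem_filter.1 ha).2]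
    simp only [h1]
    rw [← Finset.prod_fiberwise_of_maps_to (s := A) (t := A.image i) (g := i)
      (fun a ha => Finset.mem_image_of_mem i ha)]
    conv_rhs => rw [← Finset.map_orderEmbOfFin_univ (A.image i) hm, Finset.prod_map]
    rfl

end Holder

/-! ### Large gaps in finite sets of times -/

section Gap

/-- If every nonzero element `v` of `S` is at most `r w + a` for some smaller element `w` of `S`,
then the elements of `S` are bounded in terms of the number of their predecessors. -/
theorem le_geom_of_small_gaps {S : Finset ℕ} {r a : ℝ} (hr : 1 ≤ r) (ha : 0 ≤ a)
    (h : ∀ v ∈ S, v ≠ 0 → ∃ w ∈ S, w < v ∧ (v : ℝ) ≤ r * w + a) (v : ℕ) (hv : v ∈ S) :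
    (v : ℝ) ≤ a * ∑ i ∈ Finset.range (S.filter (· < v)).card, r ^ i := by
  have hr0 : 0 ≤ r := by linarith
  induction v using Nat.strong_induction_on with
  | _ v ih =>
    by_cases h0 : v = 0
    · subst h0
      simp
    obtain ⟨w, hw, hwv, hle⟩ := h v hv h0
    have hcard : (S.filter (· < w)).card + 1 ≤ (S.filter (· < v)).card := by
      refine Nat.succ_le_of_lt (Finset.card_lt_card ⟨fun x hx => ?_, fun hsub => ?_⟩)
      · simp only [Finset.mem_filter] at hx ⊢
        exact ⟨hx.1, hx.2.trans hwv⟩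
      · have := hsub (Finset.mem_filter.2 ⟨hw, hwv⟩)
        simp at this
    have hgeom : ∑ i ∈ Finset.range ((S.filter (· < w)).card + 1), r ^ i ≤
        ∑ i ∈ Finset.range (S.filter (· < v)).card, r ^ i :=
      Finset.sum_le_sum_of_subset_of_nonneg (Finset.range_mono hcard) fun _ _ _ => by positivity
    -- Multiplying the geometric sum for `w` by `r` and adding 1 gives the sum with one more term,
    -- which matches `v ≤ r w + a`.
    rw [Finset.sum_range_succ'] at hgeom
    simp only [pow_succ, ← Finset.sum_mul, pow_zero] at hgeom
    have := mul_le_mul_of_nonneg_left (ih w hwv hw) hr0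
    have := mul_le_mul_of_nonneg_left hgeom ha
    linarith

/-- Among finitely many times starting at `0`, there is a gap which is large with respect to the
diameter of the times before it and to the total diameter. -/
theorem exists_large_gap {S : Finset ℕ} {r : ℝ} (hr : 1 ≤ r) {m : ℕ} (hm : S.card ≤ m)
    (h0 : 0 ∈ S) {D : ℕ} (hD : D ∈ S) (hD0 : D ≠ 0) :
    ∃ v ∈ S, 0 < v ∧ ∃ w : ℕ, (∀ s ∈ S, s < v → s ≤ w) ∧
      (1 + ∑ i ∈ Finset.range m, r ^ i)⁻¹ * D ≤ v - r * w := by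
  have hr0 : 0 ≤ r := by linarith
  -- If every gap is small, `le_geom_of_small_gaps` with `a = c D` gives `D ≤ c D ∑ r^i = D - c D`,
  -- which is impossible.
  by_contra! hcon
  set c := (1 + ∑ i ∈ Finset.range m, r ^ i)⁻¹ with hc
  have hs : 0 ≤ ∑ i ∈ Finset.range m, r ^ i := by positivity
  have hc0 : 0 < c := by positivity
  have hle := le_geom_of_small_gaps (S := S) hr (a := c * D) (by positivity) (fun v hv hv0 => by
    have hne : (S.filter (· < v)).Nonempty :=
      ⟨0, Finset.mem_filter.2 ⟨h0, Nat.pos_of_ne_zero hv0⟩⟩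
    have hmem := Finset.mem_filter.1 (Finset.max'_mem _ hne)
    refine ⟨_, hmem.1, hmem.2, ?_⟩
    have := hcon v hv (Nat.pos_of_ne_zero hv0) ((S.filter (· < v)).max' hne) fun s hs hsv =>
      Finset.le_max' _ _ (Finset.mem_filter.2 ⟨hs, hsv⟩)
    linarith) D hD
  have h1 : ∑ i ∈ Finset.range (S.filter (· < D)).card, r ^ i ≤ ∑ i ∈ Finset.range m, r ^ i :=
    Finset.sum_le_sum_of_subset_of_nonneg
      (Finset.range_mono ((Finset.card_filter_le _ _).trans hm)) fun _ _ _ => by positivity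
  have hDpos : (0 : ℝ) < D := by exact_mod_cast Nat.pos_of_ne_zero hD0
  have h2 := mul_le_mul_of_nonneg_left h1 (a := c * D) (by positivity)
  have h3 : c * (1 + ∑ i ∈ Finset.range m, r ^ i) = 1 := inv_mul_cancel₀ (by positivity)
  have h4 : c * D * ∑ i ∈ Finset.range m, r ^ i = D - c * D := by linear_combination D * h3
  have : 0 < c * D := by positivity
  linarith

end Gap

/-! ### Invariance of covariances and decorrelation of two groups -/

theorem integral_comp_iterate {Ω : Type*} [MeasurableSpace Ω] {ν : Measure Ω} {T : Ω → Ω}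
    (hT : MeasurePreserving T ν ν) {g : Ω → ℂ} (hg : Measurable g)
    (n : ℕ) : ∫ ω, g (T^[n] ω) ∂ν = ∫ ω, g ω ∂ν := by
  have h := hT.iterate n
  conv_rhs => rw [← h.map_eq]
  rw [integral_map h.measurable.aemeasurable hg.aestronglyMeasurable]

theorem cov_comp_iterate {Ω : Type*} [MeasurableSpace Ω] {ν : Measure Ω} {T : Ω → Ω}
    (hT : MeasurePreserving T ν ν) {f g : Ω → ℂ} (hf : Measurable f)
    (hg : Measurable g) (n : ℕ) :
    cov ν (fun ω => f (T^[n] ω)) (fun ω => g (T^[n] ω)) = cov ν f g := by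
  rw [cov, cov, integral_comp_iterate hT hf, integral_comp_iterate hT hg,
    integral_comp_iterate hT (g := fun ω => f ω * g ω) (hf.mul hg)]

section Moments

variable {Ω : Type*} [MetricSpace Ω] [MeasurableSpace Ω] [BorelSpace Ω] {ν : Measure Ω}
  {T : Ω → Ω} {η r : ℝ}

theorem measurable_prod_iterate (hT : Measurable T) (hη : 0 < η) {ι : Type*} {f : ι → Ω → ℂ}
    (hf : ∀ a, UnitHolder η 1 (f a)) (A : Finset ι) (i : ι → ℕ) :
    Measurable fun ω => ∏ a ∈ A, f a (T^[i a] ω) :=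
  Finset.measurable_prod _ fun a _ => ((hf a).continuous hη).measurable.comp (hT.iterate _)

theorem eval_mono_of_coeff_nonneg {P : Polynomial ℝ} (hP : ∀ i, 0 ≤ P.coeff i) {x y : ℝ}
    (hx : 0 ≤ x) (hxy : x ≤ y) : P.eval x ≤ P.eval y := by
  rw [Polynomial.eval_eq_sum_range, Polynomial.eval_eq_sum_range]
  exact Finset.sum_le_sum fun i _ => by gcongr; exact hP i

theorem eval_nonneg_of_coeff_nonneg {P : Polynomial ℝ} (hP : ∀ i, 0 ≤ P.coeff i) {x : ℝ}
    (hx : 0 ≤ x) : 0 ≤ P.eval x := by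
  rw [Polynomial.eval_eq_sum_range]
  exact Finset.sum_nonneg fun i _ => mul_nonneg (hP i) (by positivity)

/-- Decorrelation of two groups of observables at possibly repeated times. -/
theorem MultipleDecorrelation.cov_le (hP : MultipleDecorrelation ν T η r)
    (hT : MeasurePreserving T ν ν) (hη : 0 < η) (hr : 0 ≤ r) :
    ∃ (P : Polynomial ℝ) (δ : ℝ), (∀ i, 0 ≤ P.coeff i) ∧ 0 < δ ∧ δ < 1 ∧
      ∀ {ι : Type} [Fintype ι] (f : ι → Ω → ℂ), (∀ a, UnitHolder η 1 (f a)) →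
      ∀ (A B : Finset ι), A.Nonempty → B.Nonempty → ∀ (i : ι → ℕ) (u n K L : ℕ),
      (∀ a ∈ A, u ≤ i a ∧ i a ≤ u + K) → (∀ b ∈ B, u + n ≤ i b ∧ i b ≤ u + n + L) →
      ‖cov ν (fun ω => ∏ a ∈ A, f a (T^[i a] ω)) (fun ω => ∏ b ∈ B, f b (T^[i b] ω))‖ ≤
        (1 + 2 * Fintype.card ι ^ 2) * P.eval (L : ℝ) * δ ^ ((n : ℝ) - r * K) := by
  classical
  obtain ⟨P, δ, hcoef, hδ0, hδ1, h⟩ := hP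
  refine ⟨P, δ, hcoef, hδ0, hδ1, ?_⟩
  intro ι _ f hf A B hA hB i u n K L hiA hiB
  obtain ⟨m, k, g, hm, hk, hkK, hg, hgA⟩ := exists_strictMono_prod_eq hf hA T
    (i := fun a => i a - u) (K := K) fun a ha => by have := hiA a ha; omega
  obtain ⟨m', l, g', hm', hl, hlL, hg', hgB⟩ := exists_strictMono_prod_eq hf hB T
    (i := fun a => i a - (u + n)) (K := L) fun a ha => by have := hiB a ha; omega
  have hcA : (A.card : ℝ) ≤ Fintype.card ι := by exact_mod_cast A.card_le_univ
  have hcB : (B.card : ℝ) ≤ Fintype.card ι := by exact_mod_cast B.card_le_univ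
  have hU : ∀ j, UnitHolder η (Fintype.card ι) (Sum.elim g g' j) := by
    rintro (j | j)
    · exact (hg j).mono hcA
    · exact (hg' j).mono hcB
  have h1 := h m m' (Sum.elim g g') (fun j => (hU j).isBoundedHolder) k l hk hl n
  -- By invariance of `ν` the time origin moves to `u`, so that only the lengths `K`, `L` and the
  -- offset `n` enter.
  have hshift : cov ν (fun ω => ∏ a ∈ A, f a (T^[i a] ω)) (fun ω => ∏ b ∈ B, f b (T^[i b] ω)) =
      cov ν (fun ω => ∏ j, Sum.elim g g' (Sum.inl j) (T^[k j] ω))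
        (fun ω => ∏ j, Sum.elim g g' (Sum.inr j) (T^[n + l j] ω)) := by
    have e1 : ∀ ω, ∏ j, Sum.elim g g' (Sum.inr j) (T^[n + l j] ω) =
        ∏ b ∈ B, f b (T^[i b - u] ω) := fun ω => by
      have := hgB (T^[n] ω)
      simp only [← Function.iterate_add_apply] at this
      simp only [Sum.elim_inr, add_comm n, this]
      refine Finset.prod_congr rfl fun b hb => ?_
      have := hiB b hb
      rw [show i b - (u + n) + n = i b - u by omega]
    simp only [e1, Sum.elim_inl, hgA]
    refine Eq.trans ?_ (cov_comp_iterate hT (measurable_prod_iterate hT.measurable hη hf A _)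
      (measurable_prod_iterate hT.measurable hη hf B _) u)
    simp only [← Function.iterate_add_apply]
    congr 1 <;> funext ω
    · refine Finset.prod_congr rfl fun a ha => ?_
      rw [Nat.sub_add_cancel (hiA a ha).1]
    · refine Finset.prod_congr rfl fun b hb => ?_
      rw [Nat.sub_add_cancel (by have := hiB b hb; omega)]
  rw [hshift]
  refine h1.trans ?_
  -- There are at most `2 |ι|` fused observables, each with Hölder constant at most `|ι|`; hence the
  -- factor `1 + 2 |ι|²`.
  have hcard : ((Fintype.card (Fin (m + 1) ⊕ Fin (m' + 1)) : ℕ) : ℝ) ≤ 2 * Fintype.card ι := by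
    have := A.card_le_univ
    have := B.card_le_univ
    rw [Fintype.card_sum, Fintype.card_fin, Fintype.card_fin]
    exact_mod_cast (by omega : m + 1 + (m' + 1) ≤ 2 * Fintype.card ι)
  have hS := UnitHolder.sum_prod_le (Nat.cast_nonneg _) hU
  have hS' : 1 + ((Fintype.card (Fin (m + 1) ⊕ Fin (m' + 1)) : ℕ) : ℝ) * Fintype.card ι ≤
      1 + 2 * (Fintype.card ι : ℝ) ^ 2 := by nlinarith [Nat.cast_nonneg (α := ℝ) (Fintype.card ι)]
  have hl' : (l (Fin.last m') : ℝ) ≤ L := by exact_mod_cast hlL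
  have hk' : (k (Fin.last m) : ℝ) ≤ K := by exact_mod_cast hkK
  have hPn := eval_nonneg_of_coeff_nonneg hcoef (Nat.cast_nonneg (α := ℝ) (l (Fin.last m')))
  refine mul_le_mul (mul_le_mul (hS.trans hS')
    (eval_mono_of_coeff_nonneg hcoef (Nat.cast_nonneg _) hl') hPn (by positivity)) ?_
    (by positivity) (mul_nonneg (by positivity)
      (eval_nonneg_of_coeff_nonneg hcoef (Nat.cast_nonneg _)))
  exact Real.rpow_le_rpow_of_exponent_ge hδ0 hδ1.le (by gcongr)

end Moments

/-! ### Summation over tuples of times -/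

theorem bddAbove_range_eval_mul_pow (P : Polynomial ℝ) {θ : ℝ} (h0 : 0 ≤ θ) (h1 : θ < 1) :
    BddAbove (range fun n : ℕ => P.eval (n : ℝ) * θ ^ n) := by
  have h : Tendsto (fun n : ℕ => P.eval (n : ℝ) * θ ^ n) atTop
      (𝓝 (∑ i ∈ Finset.range (P.natDegree + 1), P.coeff i * 0)) := by
    simp only [Polynomial.eval_eq_sum_range, Finset.sum_mul, mul_assoc]
    refine tendsto_finsetSum _ fun i _ => Tendsto.const_mul _ ?_
    exact tendsto_pow_const_mul_const_pow_of_abs_lt_one i (by rwa [abs_of_nonneg h0])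
  exact h.bddAbove_range

/-- A sum of products over pairs of restrictions is a product of sums. -/
theorem sum_restrict_mul {ι : Type} [Fintype ι] [DecidableEq ι] {β : Type*} [Fintype β]
    (A : Finset ι) (u : (A → β) → ℝ) (v : ({a // a ∉ A} → β) → ℝ) :
    ∑ i : ι → β, u (fun a => i a) * v (fun a => i a) = (∑ i, u i) * ∑ i, v i := by
  rw [Fintype.sum_mul_sum, ← Fintype.sum_prod_type']
  exact Fintype.sum_equiv (Equiv.piEquivPiSubtypeProd (· ∈ A) fun _ => β) _ _ fun i => rfl

theorem summable_pow_natAbs {ρ : ℝ} (h0 : 0 ≤ ρ) (h1 : ρ < 1) :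
    Summable fun z : ℤ => ρ ^ z.natAbs :=
  Summable.of_nat_of_neg (by simpa using summable_geometric_of_lt_one h0 h1)
    (by simpa using summable_geometric_of_lt_one h0 h1)

/-- Replacing the pivot time `i a₀` by a free variable `c`, summed over all `N` values, decouples
the coordinates. Each of them then contributes at most the full two-sided geometric series. -/
theorem sum_prod_pow_natAbs_le {ι : Type} [Fintype ι] [DecidableEq ι] {ρ : ℝ} (h0 : 0 ≤ ρ)
    (h1 : ρ < 1) (a₀ : ι) (N : ℕ) :
    ∑ i : ι → Fin N, ∏ b, ρ ^ (((i b : ℕ) : ℤ) - ((i a₀ : ℕ) : ℤ)).natAbs ≤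
      N * (∑' z : ℤ, ρ ^ z.natAbs) ^ Fintype.card ι := by
  have hsum := summable_pow_natAbs h0 h1
  calc ∑ i : ι → Fin N, ∏ b, ρ ^ (((i b : ℕ) : ℤ) - ((i a₀ : ℕ) : ℤ)).natAbs
      ≤ ∑ i : ι → Fin N, ∑ c : Fin N, ∏ b, ρ ^ (((i b : ℕ) : ℤ) - ((c : ℕ) : ℤ)).natAbs :=
        Finset.sum_le_sum fun i _ => Finset.single_le_sum
          (f := fun c : Fin N => ∏ b, ρ ^ (((i b : ℕ) : ℤ) - ((c : ℕ) : ℤ)).natAbs)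
          (fun _ _ => by positivity) (Finset.mem_univ (i a₀))
    _ = ∑ c : Fin N, ∏ _b : ι, ∑ j : Fin N, ρ ^ (((j : ℕ) : ℤ) - ((c : ℕ) : ℤ)).natAbs := by
        rw [Finset.sum_comm]
        refine Finset.sum_congr rfl fun c _ => ?_
        rw [Finset.prod_univ_sum, Fintype.piFinset_univ]
    _ ≤ ∑ c : Fin N, (∑' z : ℤ, ρ ^ z.natAbs) ^ Fintype.card ι := by
        refine Finset.sum_le_sum fun c _ => ?_
        rw [Finset.prod_const, Finset.card_univ]
        refine pow_le_pow_left₀ (by positivity) ?_ _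
        have hinj : Function.Injective fun j : Fin N => ((j : ℕ) : ℤ) - ((c : ℕ) : ℤ) :=
          fun x y hxy => Fin.ext (by simpa using hxy)
        exact (Finset.sum_map Finset.univ ⟨_, hinj⟩ fun z : ℤ => ρ ^ z.natAbs).symm.trans_le
          (hsum.sum_le_tsum _ fun _ _ => by positivity)
    _ = _ := by simp

/-! ### Correlations of arbitrary order -/

section Moments

variable {Ω : Type*} [MetricSpace Ω] [MeasurableSpace Ω] [BorelSpace Ω] {ν : Measure Ω}
  [IsProbabilityMeasure ν] {T : Ω → Ω} {η r : ℝ}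

/-- The expectation of a product of observables is, up to a term decaying geometrically with the
distances between the times, a sum of products of expectations over smaller groups. -/
theorem MultipleDecorrelation.exists_norm_integral_prod_le (hP : MultipleDecorrelation ν T η r)
    (hT : MeasurePreserving T ν ν) (hη : 0 < η) (hr : 1 ≤ r) (m : ℕ) :
    ∃ C ρ : ℝ, 0 ≤ C ∧ 0 < ρ ∧ ρ < 1 ∧
      ∀ {ι : Type} [Fintype ι] [DecidableEq ι], Fintype.card ι = m →
      ∀ f : ι → Ω → ℂ, (∀ a, UnitHolder η 1 (f a)) → ∀ (i : ι → ℕ) (a₀ : ι),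
      ‖∫ ω, ∏ a, f a (T^[i a] ω) ∂ν‖ ≤
        (∑ A : Finset ι with A.Nonempty ∧ Aᶜ.Nonempty,
          ‖∫ ω, ∏ a ∈ A, f a (T^[i a] ω) ∂ν‖ * ‖∫ ω, ∏ a ∈ Aᶜ, f a (T^[i a] ω) ∂ν‖) +
        C * ∏ b, ρ ^ ((i b : ℤ) - (i a₀ : ℤ)).natAbs := by
  have hr0 : 0 ≤ r := by linarith
  obtain ⟨P, δ, hcoef, hδ0, hδ1, hcov⟩ := hP.cov_le hT hη hr0
  set c := (1 + ∑ j ∈ Finset.range m, r ^ j)⁻¹ with hc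
  have hc0 : 0 < c := by positivity
  -- A gap of size `c D` gives `δ^{cD} = θ^D θ^D`: one factor absorbs the polynomial `P(D)`, the
  -- other is the decay that remains.
  set θ := δ ^ (c / 2) with hθ
  have hθ0 : 0 < θ := by positivity
  have hθ1 : θ < 1 := Real.rpow_lt_one hδ0.le hδ1 (by positivity)
  obtain ⟨C₀, hC₀⟩ := bddAbove_range_eval_mul_pow P hθ0.le hθ1
  replace hC₀ : ∀ n : ℕ, P.eval (n : ℝ) * θ ^ n ≤ C₀ := fun n => hC₀ ⟨n, rfl⟩
  have hC₀0 : 0 ≤ C₀ := (mul_nonneg (eval_nonneg_of_coeff_nonneg hcoef (Nat.cast_nonneg 0))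
    (by positivity)).trans (hC₀ 0)
  -- The decay in the diameter `D` is shared among the `m` times. The root of order `m + 1` instead
  -- of `m` keeps `ρ < 1` when `m = 0`.
  set ρ := θ ^ ((m + 1 : ℕ) : ℝ)⁻¹ with hρ
  have hρ0 : 0 < ρ := by positivity
  have hρ1 : ρ < 1 := Real.rpow_lt_one hθ0.le hθ1 (by positivity)
  have hρθ : ρ ^ (m + 1) = θ := Real.rpow_inv_natCast_pow hθ0.le (by omega)
  -- The summand 1 serves the case `D = 0`, where all times agree, no cut exists and the trivial
  -- bound is used.
  refine ⟨(1 + 2 * (m : ℝ) ^ 2) * C₀ + 1, ρ, by positivity, hρ0, hρ1, ?_⟩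
  intro ι _ _ hcard f hf i a₀
  obtain ⟨a₁, -, ha₁⟩ := Finset.exists_min_image Finset.univ i ⟨a₀, Finset.mem_univ _⟩
  obtain ⟨a₂, -, ha₂⟩ := Finset.exists_max_image Finset.univ i ⟨a₀, Finset.mem_univ _⟩
  set D := i a₂ - i a₁ with hD
  have hprod : θ ^ D ≤ ∏ b, ρ ^ ((i b : ℤ) - (i a₀ : ℤ)).natAbs := by
    calc θ ^ D = ρ ^ ((m + 1) * D) := by rw [← hρθ, pow_mul]
      _ ≤ ρ ^ (D * m) := pow_le_pow_of_le_one hρ0.le hρ1.le (by nlinarith)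
      _ = ∏ _b : ι, ρ ^ D := by
        rw [Finset.prod_const, Finset.card_univ, hcard, pow_mul]
      _ ≤ _ := Finset.prod_le_prod (fun _ _ => by positivity) fun b _ => by
        refine pow_le_pow_of_le_one hρ0.le hρ1.le ?_
        have := ha₁ b (Finset.mem_univ _)
        have := ha₂ b (Finset.mem_univ _)
        have := ha₁ a₀ (Finset.mem_univ _)
        have := ha₂ a₀ (Finset.mem_univ _)
        omega
  have hsum0 : 0 ≤ ∑ A : Finset ι with A.Nonempty ∧ Aᶜ.Nonempty,
      ‖∫ ω, ∏ a ∈ A, f a (T^[i a] ω) ∂ν‖ * ‖∫ ω, ∏ a ∈ Aᶜ, f a (T^[i a] ω) ∂ν‖ := by positivity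
  have hCC : 0 ≤ (1 + 2 * (m : ℝ) ^ 2) * C₀ := by positivity
  by_cases hD0 : D = 0
  · have h1 : ‖∫ ω, ∏ a, f a (T^[i a] ω) ∂ν‖ ≤ 1 := by
      refine (norm_integral_le_of_norm_le_const (C := 1) (ae_of_all _ fun ω => ?_)).trans (by simp)
      rw [norm_prod]
      exact Finset.prod_le_one (fun _ _ => norm_nonneg _) fun a _ => (hf a).norm_le _
    rw [hD0, pow_zero] at hprod
    nlinarith
  set S : Finset ℕ := Finset.univ.image fun a => i a - i a₁ with hS
  have hSmem : ∀ a, i a - i a₁ ∈ S := fun a => Finset.mem_image_of_mem _ (Finset.mem_univ a)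
  obtain ⟨v, hvS, hv0, w, hw, hgap⟩ := exists_large_gap hr (S := S) (m := m)
    (by rw [← hcard]; exact Finset.card_image_le) (by simpa using hSmem a₁) (hSmem a₂) hD0
  obtain ⟨a₃, -, ha₃⟩ := Finset.mem_image.1 hvS
  set A : Finset ι := Finset.univ.filter fun a => i a - i a₁ < v with hA
  have hAne : A.Nonempty := ⟨a₁, by simp [hA, hv0]⟩
  have hAc : Aᶜ.Nonempty := ⟨a₃, by simp [hA, ha₃]⟩
  have h := hcov f hf A Aᶜ hAne hAc i (i a₁) v w D (fun a ha => by
    have h1 := hw _ (hSmem a) (Finset.mem_filter.1 ha).2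
    have h2 := ha₁ a (Finset.mem_univ _)
    omega) (fun b hb => by
    have h1 : v ≤ i b - i a₁ := by simpa [hA] using hb
    have h2 := ha₂ b (Finset.mem_univ _)
    omega)
  have hmul : ∀ ω, (∏ a ∈ A, f a (T^[i a] ω)) * ∏ a ∈ Aᶜ, f a (T^[i a] ω) =
      ∏ a, f a (T^[i a] ω) := fun ω => Finset.prod_mul_prod_compl _ _
  rw [cov] at h
  simp only [hmul] at h
  have hδ : δ ^ ((v : ℝ) - r * w) ≤ θ ^ D * θ ^ D := by
    refine (Real.rpow_le_rpow_of_exponent_ge hδ0 hδ1.le hgap).trans_eq ?_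
    rw [hθ, ← Real.rpow_natCast, ← Real.rpow_mul hδ0.le, ← Real.rpow_add hδ0]
    congr 1
    rw [hD]
    ring
  have herr : (1 + 2 * (Fintype.card ι : ℝ) ^ 2) * P.eval (D : ℝ) * δ ^ ((v : ℝ) - r * w) ≤
      (1 + 2 * (m : ℝ) ^ 2) * C₀ * θ ^ D := by
    rw [hcard]
    have hPD := eval_nonneg_of_coeff_nonneg hcoef (Nat.cast_nonneg (α := ℝ) D)
    calc _ ≤ (1 + 2 * (m : ℝ) ^ 2) * P.eval (D : ℝ) * (θ ^ D * θ ^ D) := by gcongr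
      _ = (1 + 2 * (m : ℝ) ^ 2) * (P.eval (D : ℝ) * θ ^ D) * θ ^ D := by ring
      _ ≤ _ := by gcongr; exact hC₀ D
  -- Only the cut at the large gap is used, but it depends on the times. Summing over all splittings
  -- makes the bound uniform in `i`, so that it can be summed over `i` afterwards.
  have hsingle := Finset.single_le_sum (s := Finset.univ.filter
    fun A : Finset ι => A.Nonempty ∧ Aᶜ.Nonempty) (f := fun A : Finset ι =>
      ‖∫ ω, ∏ a ∈ A, f a (T^[i a] ω) ∂ν‖ * ‖∫ ω, ∏ a ∈ Aᶜ, f a (T^[i a] ω) ∂ν‖)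
    (fun _ _ => by positivity) (Finset.mem_filter.2 ⟨Finset.mem_univ A, hAne, hAc⟩)
  have htri := norm_sub_norm_le (∫ ω, ∏ a, f a (T^[i a] ω) ∂ν)
    ((∫ ω, ∏ a ∈ A, f a (T^[i a] ω) ∂ν) * ∫ ω, ∏ a ∈ Aᶜ, f a (T^[i a] ω) ∂ν)
  rw [norm_mul] at htri
  have hfin := mul_le_mul_of_nonneg_left hprod hCC
  have : 0 ≤ ∏ b, ρ ^ ((i b : ℤ) - (i a₀ : ℤ)).natAbs := by positivity
  linarith

/-- The sum of the correlations of order `m` of centered observables over all times below `N` is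
of order `N ^ (m / 2)`. -/
theorem MultipleDecorrelation.exists_sum_norm_integral_prod_le
    (hP : MultipleDecorrelation ν T η r) (hT : MeasurePreserving T ν ν) (hη : 0 < η)
    (hr : 1 ≤ r) (m : ℕ) :
    ∃ C : ℝ, 0 ≤ C ∧ ∀ {ι : Type} [Fintype ι] [DecidableEq ι], Fintype.card ι = m →
      ∀ N : ℕ, 1 ≤ N → ∀ h : ℕ → Ω → ℂ, (∀ j, UnitHolder η 1 (h j)) →
      (∀ j, ∫ ω, h j ω ∂ν = 0) →
      ∑ i : ι → Fin N, ‖∫ ω, ∏ a, h (i a) (T^[i a] ω) ∂ν‖ ≤ C * √N ^ m := by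
  induction m using Nat.strong_induction_on with
  | _ m ih =>
    rcases Nat.lt_or_ge m 2 with hm | hm
    · refine ⟨1, zero_le_one, ?_⟩
      intro ι _ _ hcard N hN h hh hc
      -- The case `m = 1` is the only place where centering enters; without it the sum would have
      -- order `N` instead of `√N`.
      obtain rfl | rfl : m = 0 ∨ m = 1 := by omega
      · have : IsEmpty ι := Fintype.card_eq_zero_iff.1 hcard
        simp
      · obtain ⟨a, ha⟩ := Fintype.card_eq_one_iff.1 hcard
        have hu : (Finset.univ : Finset ι) = {a} := by
          ext b; simp [ha b]
        refine (Finset.sum_nonpos fun i _ => ?_).trans (by positivity)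
        simp only [hu, Finset.prod_singleton]
        rw [integral_comp_iterate hT ((hh _).continuous hη).measurable, hc, norm_zero]
    choose! c hc0 hc using ih
    obtain ⟨C₁, ρ, hC₁, hρ0, hρ1, hkey⟩ := hP.exists_norm_integral_prod_le hT hη hr m
    have hs0 : 0 ≤ ∑ k ∈ Finset.range m, c k :=
      Finset.sum_nonneg fun k hk => hc0 k (Finset.mem_range.1 hk)
    have hcs : ∀ k < m, c k ≤ ∑ k ∈ Finset.range m, c k := fun k hk =>
      Finset.single_le_sum (f := c) (fun j hj => hc0 j (Finset.mem_range.1 hj))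
        (Finset.mem_range.2 hk)
    set s := ∑ k ∈ Finset.range m, c k
    set R := ∑' z : ℤ, ρ ^ z.natAbs
    have hR : 0 ≤ R := tsum_nonneg fun _ => by positivity
    -- There are at most `2^m` splittings, and `s` dominates every constant of lower order, so each
    -- splitting contributes at most `s² √N^m`.
    refine ⟨2 ^ m * s ^ 2 + C₁ * R ^ m, by positivity, ?_⟩
    intro ι _ _ hcard N hN h hh hcen
    obtain ⟨a₀⟩ : Nonempty ι := Fintype.card_pos_iff.1 (by omega)
    have hA : ∀ A : Finset ι, A.Nonempty ∧ Aᶜ.Nonempty →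
        ∑ i : ι → Fin N, ‖∫ ω, ∏ a ∈ A, h (i a) (T^[i a] ω) ∂ν‖ *
          ‖∫ ω, ∏ a ∈ Aᶜ, h (i a) (T^[i a] ω) ∂ν‖ ≤ s ^ 2 * √N ^ m := by
      rintro A ⟨hA1, hA2⟩
      have hcA : A.card + Aᶜ.card = m := by rw [Finset.card_add_card_compl, hcard]
      have hp1 := hA1.card_pos
      have hp2 := hA2.card_pos
      have e1 : ∀ (i : ι → Fin N) ω, ∏ a ∈ A, h (i a) (T^[i a] ω) =
          ∏ a : A, h (i a) (T^[i a] ω) := fun i ω =>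
        (Finset.prod_coe_sort A fun a => h (i a) (T^[i a] ω)).symm
      have e2 : ∀ (i : ι → Fin N) ω, ∏ a ∈ Aᶜ, h (i a) (T^[i a] ω) =
          ∏ a : {a // a ∉ A}, h (i a) (T^[i a] ω) := fun i ω =>
        Finset.prod_subtype _ (fun _ => Finset.mem_compl) _
      simp only [e1, e2]
      -- For a fixed splitting the two factors depend on disjoint sets of times, so the sum
      -- factorizes and the induction hypothesis applies to each factor.
      rw [sum_restrict_mul A (fun i : A → Fin N => ‖∫ ω, ∏ a, h (i a) (T^[i a] ω) ∂ν‖)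
        (fun i : {a // a ∉ A} → Fin N => ‖∫ ω, ∏ a, h (i a) (T^[i a] ω) ∂ν‖)]
      have b1 := hc A.card (by omega) (ι := A) (Fintype.card_coe A) N hN h hh hcen
      have b2 := hc Aᶜ.card (by omega) (ι := {a // a ∉ A})
        (by rw [Fintype.card_subtype_compl, Fintype.card_coe, Finset.card_compl]) N hN h hh hcen
      refine (mul_le_mul b1 b2 (by positivity)
        (mul_nonneg (hc0 _ (by omega)) (by positivity))).trans ?_
      rw [mul_mul_mul_comm, ← pow_add, hcA, sq]
      gcongr
      · exact hc0 _ (by omega)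
      · exact hcs _ (by omega)
      · exact hcs _ (by omega)
    refine (Finset.sum_le_sum fun i _ => hkey hcard (fun a => h (i a)) (fun a => hh _)
      (fun a => i a) a₀).trans ?_
    rw [Finset.sum_add_distrib, Finset.sum_comm, ← Finset.mul_sum, add_mul]
    refine add_le_add ?_ ?_
    · refine (Finset.sum_le_card_nsmul _ _ _ fun A hA' => hA A (Finset.mem_filter.1 hA').2).trans ?_
      have hcf := Finset.card_filter_le (Finset.univ : Finset (Finset ι))
        fun A => A.Nonempty ∧ Aᶜ.Nonempty
      rw [Finset.card_univ, Fintype.card_finset, hcard] at hcf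
      rw [nsmul_eq_mul, mul_assoc]
      gcongr
      exact_mod_cast hcf
    · have hN' : (1 : ℝ) ≤ √N := Real.one_le_sqrt.2 (by exact_mod_cast hN)
      -- The error terms sum to order `N`, which is admissible exactly because `m ≥ 2`.
      have hNm : (N : ℝ) ≤ √N ^ m :=
        calc (N : ℝ) = √N ^ 2 := (Real.sq_sqrt (Nat.cast_nonneg _)).symm
          _ ≤ √N ^ m := pow_le_pow_right₀ hN' hm
      have := sum_prod_pow_natAbs_le hρ0.le hρ1 a₀ N
      rw [hcard] at this
      calc _ ≤ C₁ * (N * R ^ m) := by gcongr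
        _ ≤ C₁ * (√N ^ m * R ^ m) := by gcongr
        _ = _ := by ring

end Moments

/-! ### A dyadic maximal inequality -/

section Maximal

variable {Ω : Type*}

/-- A dyadic majorant of the maximal partial sum `max_{k ≤ 2 ^ N} |∑_{j < k} X (a + j)|`. -/
def dyadicMax (X : ℕ → Ω → ℝ) : ℕ → ℕ → Ω → ℝ
  | 0, a, ω => |X a ω|
  | N + 1, a, ω => |∑ j ∈ Finset.range (2 ^ N), X (a + j) ω| +
      max (dyadicMax X N a ω) (dyadicMax X N (a + 2 ^ N) ω)

theorem dyadicMax_nonneg (X : ℕ → Ω → ℝ) (N a : ℕ) (ω : Ω) : 0 ≤ dyadicMax X N a ω := by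
  induction N generalizing a with
  | zero => exact abs_nonneg _
  | succ N ih => exact add_nonneg (abs_nonneg _) (le_max_of_le_left (ih a))

/-- A partial sum that passes the midpoint of the block is the full sum over the first half plus a
partial sum of the second half; otherwise it lies in the first half. -/
theorem abs_sum_le_dyadicMax (X : ℕ → Ω → ℝ) (N a k : ℕ) (hk : k ≤ 2 ^ N) (ω : Ω) :
    |∑ j ∈ Finset.range k, X (a + j) ω| ≤ dyadicMax X N a ω := by
  induction N generalizing a k with
  | zero =>
    obtain rfl | rfl : k = 0 ∨ k = 1 := by rw [pow_zero] at hk; omega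
    · simpa using dyadicMax_nonneg X 0 a ω
    · simp [dyadicMax]
  | succ N ih =>
    rw [dyadicMax]
    rcases le_total k (2 ^ N) with h | h
    · exact le_add_of_nonneg_of_le (abs_nonneg _) (le_max_of_le_left (ih a k h))
    · obtain ⟨l, rfl⟩ := Nat.exists_eq_add_of_le h
      rw [Finset.sum_range_add]
      refine (abs_add_le _ _).trans (add_le_add le_rfl (le_max_of_le_right ?_))
      simpa only [add_assoc] using ih (a + 2 ^ N) l (by rw [pow_succ] at hk; omega)

variable [MeasurableSpace Ω] {ν : Measure Ω}

theorem measurable_dyadicMax {X : ℕ → Ω → ℝ} (hX : ∀ j, Measurable (X j)) (N a : ℕ) :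
    Measurable (dyadicMax X N a) := by
  induction N generalizing a with
  | zero => exact (hX a).abs
  | succ N ih =>
    exact (Finset.measurable_sum _ fun j _ => hX (a + j)).abs.add ((ih a).max (ih _))

/-- Pointwise `|max(f, g)|^r ≤ |f|^r + |g|^r`, which costs a factor `2^{1/r} ≤ 2^{1/4}`, smaller
than the factor 2 of the triangle inequality and smaller than `√2`. -/
theorem eLpNorm_max_le {f g : Ω → ℝ} (hf : Measurable f) {r A : ℝ}
    (hr : 4 ≤ r) (hA : 0 ≤ A) (hfA : eLpNorm f (ENNReal.ofReal r) ν ≤ ENNReal.ofReal A)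
    (hgA : eLpNorm g (ENNReal.ofReal r) ν ≤ ENNReal.ofReal A) :
    eLpNorm (fun ω => max (f ω) (g ω)) (ENNReal.ofReal r) ν ≤
      ENNReal.ofReal (2 ^ (1 / 4 : ℝ) * A) := by
  have hr0 : 0 < r := by linarith
  have hp0 : ENNReal.ofReal r ≠ 0 := by simpa using hr0
  rw [eLpNorm_eq_lintegral_rpow_enorm_toReal hp0 ENNReal.ofReal_ne_top,
    ENNReal.toReal_ofReal hr0.le, one_div r, ENNReal.rpow_inv_le_iff hr0] at hfA hgA ⊢
  calc ∫⁻ ω, ‖max (f ω) (g ω)‖ₑ ^ r ∂ν ≤ ∫⁻ ω, (‖f ω‖ₑ ^ r + ‖g ω‖ₑ ^ r) ∂ν := by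
        refine lintegral_mono fun ω => ?_
        rcases max_choice (f ω) (g ω) with h | h <;> rw [h]
        · exact le_self_add
        · exact le_add_self
    _ = ∫⁻ ω, ‖f ω‖ₑ ^ r ∂ν + ∫⁻ ω, ‖g ω‖ₑ ^ r ∂ν :=
        lintegral_add_left (hf.enorm.pow_const r) _
    _ ≤ ENNReal.ofReal A ^ r + ENNReal.ofReal A ^ r := add_le_add hfA hgA
    _ = ENNReal.ofReal (2 * A ^ r) := by
        rw [ENNReal.ofReal_rpow_of_nonneg hA hr0.le, ← ENNReal.ofReal_add (by positivity)
          (by positivity), two_mul]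
    _ ≤ _ := by
        rw [ENNReal.ofReal_rpow_of_nonneg (by positivity) hr0.le]
        refine ENNReal.ofReal_le_ofReal ?_
        rw [Real.mul_rpow (by positivity) hA, ← Real.rpow_mul (by norm_num)]
        gcongr
        calc (2 : ℝ) = 2 ^ (1 : ℝ) := (Real.rpow_one 2).symm
          _ ≤ _ := Real.rpow_le_rpow_of_exponent_le (by norm_num) (by linarith)

/-- A maximal inequality: the maximal partial sum has the same order as the partial sums. -/
theorem eLpNorm_dyadicMax_le {X : ℕ → Ω → ℝ} (hX : ∀ j, Measurable (X j)) {r C : ℝ}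
    (hr : 4 ≤ r) (hC : 0 ≤ C)
    (h : ∀ a k : ℕ, eLpNorm (fun ω => ∑ j ∈ Finset.range k, X (a + j) ω) (ENNReal.ofReal r) ν ≤
      ENNReal.ofReal (C * √k)) (N a : ℕ) :
    eLpNorm (dyadicMax X N a) (ENNReal.ofReal r) ν ≤ ENNReal.ofReal (5 * C * √(2 ^ N : ℕ)) := by
  induction N generalizing a with
  | zero =>
    have h1 := h a 1
    simp only [Finset.range_one, Finset.sum_singleton, add_zero] at h1
    have h2 : eLpNorm (dyadicMax X 0 a) (ENNReal.ofReal r) ν =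
        eLpNorm (X a) (ENNReal.ofReal r) ν := eLpNorm_congr_norm_ae (ae_of_all _ fun ω => by
      simp [dyadicMax])
    rw [h2]
    refine h1.trans (ENNReal.ofReal_le_ofReal ?_)
    simp
    linarith
  | succ N ih =>
    have hmax := eLpNorm_max_le (measurable_dyadicMax hX N a) hr (by positivity) (ih a)
      (ih (a + 2 ^ N))
    have hS : Measurable fun ω => ∑ j ∈ Finset.range (2 ^ N), X (a + j) ω :=
      Finset.measurable_sum _ fun j _ => hX (a + j)
    have habs : eLpNorm (fun ω => |∑ j ∈ Finset.range (2 ^ N), X (a + j) ω|)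
        (ENNReal.ofReal r) ν ≤ ENNReal.ofReal (C * √(2 ^ N : ℕ)) :=
      (eLpNorm_congr_norm_ae (ae_of_all _ fun ω => by simp)).trans_le (h a (2 ^ N))
    have hadd := eLpNorm_add_le (μ := ν) (p := ENNReal.ofReal r) hS.abs.aestronglyMeasurable
      ((measurable_dyadicMax hX N a).max
        (measurable_dyadicMax hX N (a + 2 ^ N))).aestronglyMeasurable
      (by rw [← ENNReal.ofReal_one]; exact ENNReal.ofReal_le_ofReal (by linarith))
    refine (hadd.trans (add_le_add habs hmax)).trans ?_
    rw [← ENNReal.ofReal_add (by positivity) (by positivity)]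
    refine ENNReal.ofReal_le_ofReal ?_
    -- The constant 5 closes the induction: `1 + 5 · 2^{1/4} ≤ 7 ≤ 5 √2`.
    have h4 : (2 : ℝ) ^ (1 / 4 : ℝ) ≤ 6 / 5 := by
      rw [one_div, Real.rpow_inv_le_iff_of_pos (by norm_num) (by norm_num) (by norm_num)]
      norm_num
    have h2 : (7 : ℝ) / 5 ≤ √2 := Real.le_sqrt_of_sq_le (by norm_num)
    have hN : √((2 ^ (N + 1) : ℕ) : ℝ) = √2 * √((2 ^ N : ℕ) : ℝ) := by
      rw [← Real.sqrt_mul (by norm_num)]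
      push_cast
      rw [pow_succ']
    rw [hN]
    have hCN : 0 ≤ C * √((2 ^ N : ℕ) : ℝ) := by positivity
    calc _ = (1 + 5 * 2 ^ (1 / 4 : ℝ)) * (C * √((2 ^ N : ℕ) : ℝ)) := by ring
      _ ≤ (5 * √2) * (C * √((2 ^ N : ℕ) : ℝ)) := by gcongr; linarith
      _ = _ := by ring

end Maximal

/-! ### Moments of sums of centered observables -/

section Moments

variable {Ω : Type*} [MetricSpace Ω] [MeasurableSpace Ω] [BorelSpace Ω] {ν : Measure Ω}
  [IsProbabilityMeasure ν] {T : Ω → Ω} {η r : ℝ}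

theorem UnitHolder.measurable_real {c : ℝ} {g : Ω → ℝ} (hη : 0 < η)
    (hg : UnitHolder η c fun ω => (g ω : ℂ)) : Measurable g := by
  exact Complex.measurable_re.comp (hg.continuous hη).measurable

/-- The power is multiplied out into a sum over `m`-tuples of times. The observable may change with
the time, as is needed for a field evaluated along a moving trajectory. -/
theorem MultipleDecorrelation.exists_integral_sum_pow_le
    (hP : MultipleDecorrelation ν T η r) (hT : MeasurePreserving T ν ν) (hη : 0 < η)
    (hr : 1 ≤ r) (m : ℕ) :
    ∃ C : ℝ, 0 ≤ C ∧ ∀ N : ℕ, 1 ≤ N → ∀ g : ℕ → Ω → ℝ,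
      (∀ j, UnitHolder η 1 fun ω => (g j ω : ℂ)) → (∀ j, ∫ ω, g j ω ∂ν = 0) →
      ∫ ω, (∑ j ∈ Finset.range N, g j (T^[j] ω)) ^ m ∂ν ≤ C * √N ^ m := by
  obtain ⟨C, hC, h⟩ := hP.exists_sum_norm_integral_prod_le hT hη hr m
  refine ⟨C, hC, fun N hN g hg hcen => ?_⟩
  have hsum := h (ι := Fin m) (Fintype.card_fin m) N hN (fun j ω => (g j ω : ℂ)) hg fun j => by
    rw [integral_complex_ofReal, hcen, Complex.ofReal_zero]
  refine le_trans ?_ hsum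
  have heq : ((∫ ω, (∑ j ∈ Finset.range N, g j (T^[j] ω)) ^ m ∂ν : ℝ) : ℂ) =
      ∑ i : Fin m → Fin N, ∫ ω, ∏ a, (g (i a) (T^[i a] ω) : ℂ) ∂ν := by
    rw [← integral_complex_ofReal, ← integral_finsetSum]
    · congr 1
      funext ω
      push_cast
      rw [Finset.sum_range, Fintype.sum_pow]
    · intro i _
      refine Integrable.of_bound (measurable_prod_iterate hT.measurable hη
        (fun a => hg (i a)) Finset.univ _).aestronglyMeasurable 1 (ae_of_all _ fun ω => ?_)
      rw [norm_prod]
      exact Finset.prod_le_one (fun _ _ => norm_nonneg _) fun a _ => (hg (i a)).norm_le _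
  refine (le_abs_self _).trans ?_
  rw [← Real.norm_eq_abs, ← Complex.norm_real, heq]
  exact norm_sum_le _ _

/-- By invariance of `ν` a block starting at `a` reduces to one starting at 0. The exponent `2q` is
an even integer, so the absolute moment is an ordinary moment. -/
theorem MultipleDecorrelation.exists_eLpNorm_sum_le
    (hP : MultipleDecorrelation ν T η r) (hT : MeasurePreserving T ν ν) (hη : 0 < η)
    (hr : 1 ≤ r) (q : ℕ) (hq : 1 ≤ q) :
    ∃ C : ℝ, 0 ≤ C ∧ ∀ g : ℕ → Ω → ℝ,
      (∀ j, UnitHolder η 1 fun ω => (g j ω : ℂ)) → (∀ j, ∫ ω, g j ω ∂ν = 0) → ∀ a N : ℕ,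
      eLpNorm (fun ω => ∑ j ∈ Finset.range N, g (a + j) (T^[a + j] ω))
        (ENNReal.ofReal (2 * q)) ν ≤ ENNReal.ofReal (C * √N) := by
  obtain ⟨C, hC, h⟩ := hP.exists_integral_sum_pow_le hT hη hr (2 * q)
  refine ⟨C ^ (1 / (2 * q) : ℝ), by positivity, fun g hg hcen a N => ?_⟩
  have hq0 : (0 : ℝ) < 2 * q := by positivity
  rcases Nat.eq_zero_or_pos N with rfl | hN
  · simp
  have hmeas : Measurable fun ω => ∑ j ∈ Finset.range N, g (a + j) (T^[j] ω) :=
    Finset.measurable_sum _ fun j _ =>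
      ((hg (a + j)).measurable_real hη).comp (hT.measurable.iterate j)
  have hcomp : (fun ω => ∑ j ∈ Finset.range N, g (a + j) (T^[a + j] ω)) =
      (fun ω => ∑ j ∈ Finset.range N, g (a + j) (T^[j] ω)) ∘ T^[a] := by
    funext ω
    simp only [Function.comp_apply, ← Function.iterate_add_apply, add_comm]
  rw [hcomp, eLpNorm_comp_measurePreserving hmeas.aestronglyMeasurable (hT.iterate a)]
  have hbd : ∀ ω, ‖∑ j ∈ Finset.range N, g (a + j) (T^[j] ω)‖ ≤ N := fun ω => by
    refine (norm_sum_le_of_le _ (n := fun _ => (1 : ℝ)) fun j _ => ?_).trans (by simp)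
    simpa using (hg (a + j)).norm_le (T^[j] ω)
  have hint := h N hN (fun j => g (a + j)) (fun j => hg _) fun j => hcen _
  rw [eLpNorm_eq_lintegral_rpow_enorm_toReal (by simp; omega) ENNReal.ofReal_ne_top,
    ENNReal.toReal_ofReal hq0.le, one_div (2 * q : ℝ), ENNReal.rpow_inv_le_iff hq0]
  have hpow : ∀ ω, ‖∑ j ∈ Finset.range N, g (a + j) (T^[j] ω)‖ₑ ^ (2 * q : ℝ) =
      ENNReal.ofReal ((∑ j ∈ Finset.range N, g (a + j) (T^[j] ω)) ^ (2 * q)) := fun ω => by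
    rw [show (2 * q : ℝ) = ((2 * q : ℕ) : ℝ) by push_cast; ring, ENNReal.rpow_natCast,
      ← ofReal_norm, ← ENNReal.ofReal_pow (norm_nonneg _), pow_mul, Real.norm_eq_abs,
      sq_abs, ← pow_mul]
  simp only [hpow]
  rw [← ofReal_integral_eq_lintegral_ofReal]
  · rw [ENNReal.ofReal_rpow_of_nonneg (by positivity) hq0.le]
    refine ENNReal.ofReal_le_ofReal (hint.trans_eq ?_)
    rw [Real.mul_rpow (by positivity) (by positivity), ← Real.rpow_mul hC,
      inv_mul_cancel₀ hq0.ne', Real.rpow_one, ← Real.rpow_natCast]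
    push_cast
    rfl
  · refine Integrable.of_bound (hmeas.pow_const _).aestronglyMeasurable ((N : ℝ) ^ (2 * q))
      (ae_of_all _ fun ω => ?_)
    rw [norm_pow]
    exact pow_le_pow_left₀ (norm_nonneg _) (hbd ω) _
  · exact ae_of_all _ fun ω => (even_two_mul q).pow_nonneg _

end Moments

/-! ### Discrete Gronwall inequality and Euler steps -/

section DiscreteGronwall

theorem discrete_gronwall {a : ℕ → ℝ} {c B : ℝ} {n : ℕ} (hc : 0 ≤ c)
    (h : ∀ k ≤ n, a k ≤ B + c * ∑ j ∈ Finset.range k, a j) (k : ℕ) (hk : k ≤ n) :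
    a k ≤ B * (1 + c) ^ k := by
  -- The induction is run on the right-hand side `B + c ∑_{j<k} a j`, which satisfies a one-step
  -- recursion.
  refine (h k hk).trans ?_
  induction k with
  | zero => simp
  | succ k ih =>
    have h1 := ih (by omega)
    have h2 := mul_le_mul_of_nonneg_left (h k (by omega)) hc
    have h3 := mul_le_mul_of_nonneg_left h1 hc
    rw [Finset.sum_range_succ, pow_succ]
    linarith

variable {E : Type*} [NormedAddCommGroup E] [NormedSpace ℝ E]

/-- Two sequences following the same Lipschitz recursion up to perturbations with bounded partial
sums stay close to each other. -/
theorem norm_sub_le_of_perturbed_recursion {u v : ℕ → E} {G : ℕ → E → E} {L : ℝ≥0}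
    (hG : ∀ j, LipschitzWith L (G j)) {h B : ℝ} (hh : 0 ≤ h) (h0 : u 0 = v 0) {n : ℕ}
    (hB : ∀ k ≤ n, ‖∑ j ∈ Finset.range k,
      ((u (j + 1) - v (j + 1)) - (u j - v j) - h • (G j (u j) - G j (v j)))‖ ≤ B)
    (k : ℕ) (hk : k ≤ n) : ‖u k - v k‖ ≤ B * Real.exp (L * (h * k)) := by
  have hB0 : 0 ≤ B := (norm_nonneg _).trans (hB 0 (Nat.zero_le _))
  refine (discrete_gronwall (a := fun k => ‖u k - v k‖) (c := h * L) (B := B) (n := n)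
    (by positivity) (fun k hk => ?_) k hk).trans ?_
  · have hb := hB k hk
    -- The increments of `u - v` telescope, so only the norm of the summed perturbations enters, not
    -- the sum of their norms.
    rw [Finset.sum_sub_distrib, Finset.sum_range_sub (fun j => u j - v j), h0, sub_self,
      sub_zero] at hb
    have hs : ‖∑ j ∈ Finset.range k, h • (G j (u j) - G j (v j))‖ ≤
        h * L * ∑ j ∈ Finset.range k, ‖u j - v j‖ := by
      rw [Finset.mul_sum]
      refine norm_sum_le_of_le _ fun j _ => ?_
      rw [norm_smul, Real.norm_of_nonneg hh, mul_assoc]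
      gcongr
      exact (hG j).norm_sub_le _ _
    have := norm_le_norm_sub_add (u k - v k) (∑ j ∈ Finset.range k, h • (G j (u j) - G j (v j)))
    linarith
  · gcongr
    calc (1 + h * L) ^ k ≤ Real.exp (h * L) ^ k := by
          gcongr
          linarith [Real.add_one_le_exp (h * L)]
      _ = _ := by
          rw [← Real.exp_nat_mul]
          ring_nf

/-- No derivative is available at the endpoints, where the perturbed field may jump. The mean value
inequality is applied on `[s, t]` with `s > a`, and then `s` tends to `a`. -/
theorem norm_sub_le_of_hasDerivAt_Ioo {f f' : ℝ → E} {a b C : ℝ} (hc : ContinuousOn f (Icc a b))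
    (hd : ∀ t ∈ Ioo a b, HasDerivAt f (f' t) t) (hC : ∀ t ∈ Ioo a b, ‖f' t‖ ≤ C) (t : ℝ)
    (ht : t ∈ Icc a b) : ‖f t - f a‖ ≤ C * (t - a) := by
  rcases ht.1.eq_or_lt with rfl | hat
  · simp
  have hlim : Tendsto f (𝓝[>] a) (𝓝 (f a)) :=
    (hc a ⟨le_rfl, hat.le.trans ht.2⟩).mono_left
      (nhdsWithin_le_of_mem (mem_of_superset (Ioo_mem_nhdsGT (hat.trans_le ht.2))
        Ioo_subset_Icc_self))
  have hlim2 : Tendsto (fun s => C * (t - s)) (𝓝[>] a) (𝓝 (C * (t - a))) :=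
    ((continuous_const.mul (continuous_const.sub continuous_id)).tendsto a).mono_left
      nhdsWithin_le_nhds
  refine le_of_tendsto_of_tendsto ((tendsto_const_nhds.sub hlim).norm) hlim2 ?_
  filter_upwards [Ioo_mem_nhdsGT hat] with s hs
  have hsub : ∀ r ∈ Ico s t, r ∈ Ioo a b := fun r hr =>
    ⟨hs.1.trans_le hr.1, hr.2.trans_le ht.2⟩
  exact norm_image_sub_le_of_norm_deriv_right_le_segment
    (hc.mono (Icc_subset_Icc hs.1.le ht.2))
    (fun r hr => (hd r (hsub r hr)).hasDerivWithinAt) (fun r hr => hC r (hsub r hr)) t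
    ⟨hs.2.le, le_rfl⟩

/-- The error of one step of Euler's method. -/
theorem norm_euler_step_le {G : E → E} {L M : ℝ≥0} (hL : LipschitzWith L G)
    (hM : ∀ x, ‖G x‖ ≤ M) {y : ℝ → E} {a h : ℝ} (hh : 0 ≤ h)
    (hc : ContinuousOn y (Icc a (a + h)))
    (hd : ∀ t ∈ Ioo a (a + h), HasDerivAt y (G (y t)) t) :
    ‖y (a + h) - y a - h • G (y a)‖ ≤ L * M * h ^ 2 := by
  have h1 := norm_sub_le_of_hasDerivAt_Ioo hc hd fun t _ => hM _
  -- Subtracting `t • G (y a)` leaves the derivative `G (y t) - G (y a)`, of norm at most `L M h`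
  -- since `y` moves by at most `M h`.
  have h2 := norm_sub_le_of_hasDerivAt_Ioo (f := fun t => y t - t • G (y a))
    (f' := fun t => G (y t) - G (y a)) (a := a) (b := a + h) (C := L * (M * h))
    (hc.sub (by fun_prop)) (fun t ht => by
      have h := (hd t ht).sub ((hasDerivAt_id t).smul_const (G (y a)))
      rw [one_smul] at h
      exact h) (fun t ht => by
      refine (hL.norm_sub_le _ _).trans ?_
      gcongr
      refine (h1 t (Ioo_subset_Icc_self ht)).trans ?_
      gcongr
      linarith [ht.2]) (a + h) ⟨by linarith, le_rfl⟩
  have e : y (a + h) - (a + h) • G (y a) - (y a - a • G (y a)) = y (a + h) - y a - h • G (y a) := by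
    rw [add_smul]
    abel
  simp only [e] at h2
  linarith

end DiscreteGronwall

/-! ### Euler approximation and measurability of the solutions -/

section Solutions

variable {Ω : Type*} {d : ℕ} {T : Ω → Ω} {F : (Fin d → ℝ) → Ω → (Fin d → ℝ)} {L M : ℝ≥0}

/-- The step `h` subdivides each interval of length ε into `N` cells, so the iterate in force on
cell `j` is `T^[j / N]`, with integer division. -/
theorem IsPerturbedSolution.hasDerivAt_cell {ε : ℝ} {x : Fin d → ℝ} {ω : Ω} {y : ℝ → Fin d → ℝ}
    (hy : IsPerturbedSolution T F ε x ω y) {h : ℝ} (hh : 0 < h) {N : ℕ} (hN : 0 < N)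
    (hε : ε = h * N) (j : ℕ) (t : ℝ) (ht : t ∈ Ioo (h * j) (h * j + h)) :
    HasDerivAt y (F (y t) (T^[j / N] ω)) t := by
  have hN' : (0 : ℝ) < N := by exact_mod_cast hN
  have ht0 : 0 ≤ t := le_trans (by positivity) ht.1.le
  have hfl : ⌊t / h⌋₊ = j := by
    rw [Nat.floor_eq_iff (by positivity)]
    constructor
    · rw [le_div_iff₀ hh]; linarith [ht.1]
    · rw [div_lt_iff₀ hh]; linarith [ht.2]
  have hfl' : ⌊t / ε⌋₊ = j / N := by
    rw [hε, ← div_div, Nat.floor_div_natCast, hfl]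
  rw [← hfl']
  refine hy.hasDerivAt t ht0 fun k hk => ?_
  -- A time `t = ε k` would be the left endpoint of its cell, whereas `t` lies in the open cell.
  have h1 : ⌊t / h⌋₊ = N * k := by
    rw [hk, hε, mul_assoc, mul_div_cancel_left₀ _ hh.ne', ← Nat.cast_mul, Nat.floor_natCast]
  rw [hfl] at h1
  have h2 := ht.1
  rw [hk, hε, h1] at h2
  push_cast at h2
  linarith

theorem IsPerturbedSolution.continuousOn_cell {ε : ℝ} {x : Fin d → ℝ} {ω : Ω}
    {y : ℝ → Fin d → ℝ} (hy : IsPerturbedSolution T F ε x ω y) {h : ℝ} (hh : 0 < h) (j : ℕ) :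
    ContinuousOn y (Icc (h * j) (h * j + h)) :=
  hy.continuousOn.mono fun t ht => le_trans (by positivity) ht.1

theorem mem_cell_floor {h t : ℝ} (hh : 0 < h) (ht : 0 ≤ t) :
    t ∈ Icc (h * ⌊t / h⌋₊) (h * ⌊t / h⌋₊ + h) := by
  have h1 := Nat.floor_le (div_nonneg ht hh.le)
  have h2 := Nat.lt_floor_add_one (t / h)
  rw [le_div_iff₀ hh] at h1
  rw [div_lt_iff₀ hh] at h2
  constructor <;> linarith

theorem IsPerturbedSolution.norm_sub_floor_le (hM : ∀ x ω, ‖F x ω‖ ≤ M) {ε : ℝ}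
    {x : Fin d → ℝ} {ω : Ω} {y : ℝ → Fin d → ℝ} (hy : IsPerturbedSolution T F ε x ω y) {h : ℝ}
    (hh : 0 < h) {N : ℕ} (hN : 0 < N) (hε : ε = h * N) {t : ℝ} (ht : 0 ≤ t) :
    ‖y t - y (h * ⌊t / h⌋₊)‖ ≤ M * h := by
  have hm := mem_cell_floor hh ht
  refine (norm_sub_le_of_hasDerivAt_Ioo (hy.continuousOn_cell hh _)
    (hy.hasDerivAt_cell hh hN hε _) (fun _ _ => hM _ _) t hm).trans ?_
  gcongr
  linarith [hm.2]

/-- Euler's scheme with step `h` for the perturbed equation with `ε = h N`. -/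
noncomputable def eulerScheme (T : Ω → Ω) (F : (Fin d → ℝ) → Ω → (Fin d → ℝ)) (h : ℝ) (N : ℕ)
    (x : Fin d → ℝ) : ℕ → Ω → (Fin d → ℝ)
  | 0, _ => x
  | j + 1, ω => eulerScheme T F h N x j ω + h • F (eulerScheme T F h N x j ω) (T^[j / N] ω)

theorem measurable_eulerScheme [MeasurableSpace Ω] (hT : Measurable T)
    (hF : Measurable (Function.uncurry F)) (h : ℝ) (N : ℕ) (x : Fin d → ℝ) (j : ℕ) :
    Measurable (eulerScheme T F h N x j) := by
  induction j with
  | zero => exact measurable_const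
  | succ j ih => exact ih.add ((hF.comp (ih.prodMk (hT.iterate _))).const_smul h)

theorem IsPerturbedSolution.norm_sub_eulerScheme_le (hL : ∀ ω, LipschitzWith L fun x => F x ω)
    (hM : ∀ x ω, ‖F x ω‖ ≤ M) {ε : ℝ} {x : Fin d → ℝ} {ω : Ω} {y : ℝ → Fin d → ℝ}
    (hy : IsPerturbedSolution T F ε x ω y) {h : ℝ} (hh : 0 < h) {N : ℕ} (hN : 0 < N)
    (hε : ε = h * N) {t : ℝ} (ht : 0 ≤ t) :
    ‖y t - eulerScheme T F h N x ⌊t / h⌋₊ ω‖ ≤ (M + L * M * t * Real.exp (L * t)) * h := by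
  have hk : h * ⌊t / h⌋₊ ≤ t := (mem_cell_floor hh ht).1
  have h1 := hy.norm_sub_floor_le hM hh hN hε ht
  have h2 := norm_sub_le_of_perturbed_recursion (u := fun j : ℕ => y (h * j))
    (v := fun j => eulerScheme T F h N x j ω) (G := fun j x => F x (T^[j / N] ω)) (L := L)
    (h := h) (B := L * M * t * h) (n := ⌊t / h⌋₊) (fun j => hL _) hh.le
    (by simp [eulerScheme, hy.initial]) (fun k hkn => by
      refine (norm_sum_le_of_le _ (n := fun _ => L * M * h ^ 2) fun j _ => ?_).trans ?_
      · have := norm_euler_step_le (hL (T^[j / N] ω)) (fun x => hM x _) hh.le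
          (hy.continuousOn_cell hh j) (hy.hasDerivAt_cell hh hN hε j)
        refine le_of_eq_of_le (congrArg _ ?_) this
        have hstep : eulerScheme T F h N x (j + 1) ω = eulerScheme T F h N x j ω +
          h • F (eulerScheme T F h N x j ω) (T^[j / N] ω) := rfl
        rw [hstep, smul_sub]
        push_cast
        rw [mul_add, mul_one]
        abel
      · rw [Finset.sum_const, Finset.card_range, nsmul_eq_mul]
        have : h * k ≤ t := le_trans (by gcongr) hk
        calc (k : ℝ) * (L * M * h ^ 2) = L * M * (h * k) * h := by ring
          _ ≤ _ := by gcongr) _ le_rfl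
  have h3 : Real.exp (L * (h * ⌊t / h⌋₊)) ≤ Real.exp (L * t) := by gcongr
  have h4 := mul_le_mul_of_nonneg_left h3 (a := L * M * t * h) (by positivity)
  refine (norm_sub_le_norm_sub_add_norm_sub _ (y (h * ⌊t / h⌋₊)) _).trans ?_
  linarith

theorem isPerturbedSolution_perturbedSolution (hL : ∀ ω, LipschitzWith L fun x => F x ω)
    (hM : ∀ x ω, ‖F x ω‖ ≤ M) {ε : ℝ} (hε : 0 < ε) (x : Fin d → ℝ) (ω : Ω) :
    IsPerturbedSolution T F ε x ω (perturbedSolution T F ε x ω) :=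
  Classical.epsilon_spec (exists_isPerturbedSolution T hL hM hε x ω)

/-- The solution is chosen separately for each `ω`, so measurability is not built in. It is
inherited from the Euler schemes of step `ε / (N + 1)`, which are measurable and converge pointwise
to the solution. -/
theorem measurable_perturbedSolution [MeasurableSpace Ω] (hT : Measurable T)
    (hF : Measurable (Function.uncurry F)) (hL : ∀ ω, LipschitzWith L fun x => F x ω)
    (hM : ∀ x ω, ‖F x ω‖ ≤ M) {ε : ℝ} (hε : 0 < ε) (x : Fin d → ℝ) {t : ℝ} (ht : 0 ≤ t) :
    Measurable fun ω => perturbedSolution T F ε x ω t := by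
  refine measurable_of_tendsto_metrizable (f := fun N : ℕ =>
    eulerScheme T F (ε / (N + 1 : ℕ)) (N + 1) x ⌊t / (ε / (N + 1 : ℕ))⌋₊)
    (fun N => measurable_eulerScheme hT hF _ _ _ _) (tendsto_pi_nhds.2 fun ω => ?_)
  rw [tendsto_iff_norm_sub_tendsto_zero]
  refine squeeze_zero (fun _ => norm_nonneg _) (fun N => ?_)
    (g := fun N : ℕ => (M + L * M * t * Real.exp (L * t)) * (ε / ((N : ℝ) + 1))) ?_
  · rw [norm_sub_rev]
    have hN : (0 : ℝ) < (N + 1 : ℕ) := by positivity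
    refine ((isPerturbedSolution_perturbedSolution hL hM hε x ω).norm_sub_eulerScheme_le hL hM
      (by positivity) (Nat.succ_pos N) (div_mul_cancel₀ _ hN.ne').symm ht).trans_eq ?_
    push_cast
    rfl
  · have := (tendsto_one_div_add_atTop_nhds_zero_nat (𝕜 := ℝ)).const_mul
      ((M + L * M * t * Real.exp (L * t)) * ε)
    rw [mul_zero] at this
    refine this.congr fun N => ?_
    ring

variable [MeasurableSpace Ω] {ν : Measure Ω}

theorem IsAveragedSolution.continuousOn {x : Fin d → ℝ} {w : ℝ → Fin d → ℝ}
    (hw : IsAveragedSolution ν F x w) : ContinuousOn w (Ici 0) :=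
  fun t ht => (hw.hasDerivWithinAt t ht).continuousWithinAt

theorem IsAveragedSolution.continuousOn_cell {x : Fin d → ℝ} {w : ℝ → Fin d → ℝ}
    (hw : IsAveragedSolution ν F x w) {h : ℝ} (hh : 0 < h) (j : ℕ) :
    ContinuousOn w (Icc (h * j) (h * j + h)) :=
  hw.continuousOn.mono fun t ht => le_trans (by positivity) ht.1

theorem IsAveragedSolution.hasDerivAt_cell {x : Fin d → ℝ} {w : ℝ → Fin d → ℝ}
    (hw : IsAveragedSolution ν F x w) {h : ℝ} (hh : 0 < h) (j : ℕ) (t : ℝ)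
    (ht : t ∈ Ioo (h * j) (h * j + h)) : HasDerivAt w (averagedField ν F (w t)) t := by
  have ht0 : 0 < t := lt_of_le_of_lt (by positivity) ht.1
  exact (hw.hasDerivWithinAt t ht0.le).hasDerivAt (Ici_mem_nhds ht0)

end Solutions

/-! ### Reduction of the error to partial sums of the centered field -/

section Error

variable {Ω : Type*} [MeasurableSpace Ω] {ν : Measure Ω} [IsProbabilityMeasure ν] {d : ℕ}
  {T : Ω → Ω} {F : (Fin d → ℝ) → Ω → (Fin d → ℝ)} {L M : ℝ≥0}

theorem integrable_field (hF : Measurable (Function.uncurry F)) (hM : ∀ x ω, ‖F x ω‖ ≤ M)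
    (x : Fin d → ℝ) : Integrable (F x) ν :=
  Integrable.of_bound (hF.comp measurable_prodMk_left).aestronglyMeasurable M (ae_of_all _ (hM x))

theorem lipschitzWith_averagedField (hF : Measurable (Function.uncurry F))
    (hL : ∀ ω, LipschitzWith L fun x => F x ω) (hM : ∀ x ω, ‖F x ω‖ ≤ M) :
    LipschitzWith L (averagedField ν F) := by
  refine LipschitzWith.of_dist_le_mul fun a b => ?_
  rw [dist_eq_norm, averagedField, averagedField,
    ← integral_sub (integrable_field hF hM a) (integrable_field hF hM b)]
  refine (norm_integral_le_of_norm_le_const (C := L * dist a b) (ae_of_all _ fun ω => ?_)).trans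
    (by simp)
  rw [← dist_eq_norm]
  exact (hL ω).dist_le_mul a b

theorem norm_averagedField_le (hM : ∀ x ω, ‖F x ω‖ ≤ M) (x : Fin d → ℝ) :
    ‖averagedField ν F x‖ ≤ M :=
  (norm_integral_le_of_norm_le_const (ae_of_all _ (hM x))).trans (by simp)

theorem isAveragedSolution_averagedSolution (hF : Measurable (Function.uncurry F))
    (hL : ∀ ω, LipschitzWith L fun x => F x ω) (hM : ∀ x ω, ‖F x ω‖ ≤ M) (x : Fin d → ℝ) :
    IsAveragedSolution ν F x (averagedSolution ν F x) :=
  Classical.epsilon_spec (exists_isAveragedSolution ν hF hL hM x)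

theorem IsAveragedSolution.norm_sub_floor_le (hM : ∀ x ω, ‖F x ω‖ ≤ M)
    {x : Fin d → ℝ} {w : ℝ → Fin d → ℝ} (hw : IsAveragedSolution ν F x w) {h : ℝ}
    (hh : 0 < h) {t : ℝ} (ht : 0 ≤ t) : ‖w t - w (h * ⌊t / h⌋₊)‖ ≤ M * h := by
  have hm := mem_cell_floor hh ht
  refine (norm_sub_le_of_hasDerivAt_Ioo (hw.continuousOn_cell hh _)
    (hw.hasDerivAt_cell hh _) (fun _ _ => norm_averagedField_le hM _) t hm).trans ?_
  gcongr
  linarith [hm.2]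

theorem measurable_maxError (hT : Measurable T) (hF : Measurable (Function.uncurry F))
    (hL : ∀ ω, LipschitzWith L fun x => F x ω) (hM : ∀ x ω, ‖F x ω‖ ≤ M) {T₀ : ℝ} (hT₀ : 0 < T₀)
    {ε : ℝ} (hε : 0 < ε) (x : Fin d → ℝ) : Measurable (maxError ν T F T₀ ε x) := by
  have : Nonempty (Icc (0 : ℝ) T₀) := ⟨⟨0, le_rfl, hT₀.le⟩⟩
  -- Since the error is continuous in `t`, the supremum may be taken over a countable dense set of
  -- times.
  have heq : maxError ν T F T₀ ε x = fun ω =>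
      ⨆ n : ℕ, ‖errorTerm ν T F ε (TopologicalSpace.denseSeq (Icc (0 : ℝ) T₀) n) x ω‖ₑ := by
    funext ω
    have hcont : Continuous fun t : Icc (0 : ℝ) T₀ => ‖errorTerm ν T F ε t x ω‖ₑ := by
      refine continuous_enorm.comp (continuousOn_iff_continuous_domRestrict.1 (ContinuousOn.sub ?_ ?_))
      · exact (isPerturbedSolution_perturbedSolution hL hM hε x ω).continuousOn.mono
          Icc_subset_Ici_self
      · exact (isAveragedSolution_averagedSolution hF hL hM x).continuousOn.mono
          Icc_subset_Ici_self
    rw [maxError, iSup_subtype']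
    refine le_antisymm (iSup_le fun t => ?_)
      (iSup_le fun n => le_iSup (fun t : Icc (0 : ℝ) T₀ => ‖errorTerm ν T F ε t x ω‖ₑ) _)
    have hclosed := isClosed_Iic.preimage hcont (t := Iic
      (⨆ n : ℕ, ‖errorTerm ν T F ε (TopologicalSpace.denseSeq (Icc (0 : ℝ) T₀) n) x ω‖ₑ))
    have hsub : closure (range (TopologicalSpace.denseSeq (Icc (0 : ℝ) T₀))) ⊆ _ :=
      hclosed.closure_subset_iff.2 (range_subset_iff.2 fun n => le_iSup (fun n =>
        ‖errorTerm ν T F ε (TopologicalSpace.denseSeq (Icc (0 : ℝ) T₀) n) x ω‖ₑ) n)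
    exact hsub (TopologicalSpace.denseRange_denseSeq _ t)
  rw [heq]
  exact Measurable.iSup fun n =>
    ((measurable_perturbedSolution hT hF hL hM hε x
      (TopologicalSpace.denseSeq (Icc (0 : ℝ) T₀) n).2.1).sub measurable_const).enorm

/-- The maximal error is controlled by the partial sums of the centered field along the averaged
trajectory. -/
theorem maxError_le (hF : Measurable (Function.uncurry F))
    (hL : ∀ ω, LipschitzWith L fun x => F x ω) (hM : ∀ x ω, ‖F x ω‖ ≤ M) {T₀ : ℝ} (hT₀ : 0 < T₀)
    {ε : ℝ} (hε : 0 < ε) (x : Fin d → ℝ) (ω : Ω) {B : ℝ}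
    (hB : ∀ k ≤ ⌊T₀ / ε⌋₊, ‖∑ j ∈ Finset.range k,
      (F (averagedSolution ν F x (ε * j)) (T^[j] ω) -
        averagedField ν F (averagedSolution ν F x (ε * j)))‖ ≤ B) :
    maxError ν T F T₀ ε x ω ≤ ENNReal.ofReal
      ((2 * M + 2 * L * M * T₀ * Real.exp (L * T₀)) * ε + Real.exp (L * T₀) * ε * B) := by
  have hB0 : 0 ≤ B := (norm_nonneg _).trans (hB 0 (Nat.zero_le _))
  have hy := isPerturbedSolution_perturbedSolution (T := T) hL hM hε x ω
  have hw := isAveragedSolution_averagedSolution (ν := ν) hF hL hM x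
  set y := perturbedSolution T F ε x ω with hy_def
  set w := averagedSolution ν F x with hw_def
  have hε1 : ε = ε * (1 : ℕ) := by simp
  -- Both sequences are compared through `F(·, T^j ω)`. The perturbation is then two Euler errors,
  -- at most `2 L M ε²` per step over at most `T₀/ε` steps, plus ε times the centered field along
  -- `w`, whose partial sums are bounded by `B`.
  have hgrid := norm_sub_le_of_perturbed_recursion (u := fun j : ℕ => y (ε * j))
    (v := fun j : ℕ => w (ε * j)) (G := fun j x => F x (T^[j] ω)) (L := L) (h := ε)
    (B := 2 * L * M * T₀ * ε + ε * B) (n := ⌊T₀ / ε⌋₊) (fun j => hL _) hε.le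
    (by simp [hy.initial, hw.initial]) (fun k hk => by
      have hsplit : ∀ j : ℕ, (y (ε * (j + 1 : ℕ)) - w (ε * (j + 1 : ℕ))) - (y (ε * j) - w (ε * j)) -
          ε • (F (y (ε * j)) (T^[j] ω) - F (w (ε * j)) (T^[j] ω)) =
          ((y (ε * j + ε) - y (ε * j) - ε • F (y (ε * j)) (T^[j / 1] ω)) -
          (w (ε * j + ε) - w (ε * j) - ε • averagedField ν F (w (ε * j)))) +
          ε • (F (w (ε * j)) (T^[j] ω) - averagedField ν F (w (ε * j))) := fun j => by
        rw [Nat.div_one, Nat.cast_add_one, mul_add, mul_one, smul_sub, smul_sub]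
        abel
      simp only [hsplit]
      rw [Finset.sum_add_distrib, ← Finset.smul_sum]
      refine (norm_add_le _ _).trans (add_le_add ?_ ?_)
      · refine (norm_sum_le_of_le _ (n := fun _ => 2 * (L * M * ε ^ 2)) fun j _ => ?_).trans ?_
        · refine (norm_sub_le _ _).trans ?_
          have h1 := norm_euler_step_le (hL (T^[j / 1] ω)) (fun x => hM x _) hε.le
            (hy.continuousOn_cell hε j) (hy.hasDerivAt_cell hε one_pos hε1 j)
          have h2 := norm_euler_step_le (lipschitzWith_averagedField hF hL hM)
            (norm_averagedField_le hM) hε.le (hw.continuousOn_cell hε j) (hw.hasDerivAt_cell hε j)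
          linarith
        · rw [Finset.sum_const, Finset.card_range, nsmul_eq_mul]
          have : ε * k ≤ T₀ := le_trans (by gcongr) (mem_cell_floor hε hT₀.le).1
          calc (k : ℝ) * (2 * (L * M * ε ^ 2)) = 2 * L * M * (ε * k) * ε := by ring
            _ ≤ _ := by gcongr
      · rw [norm_smul, Real.norm_of_nonneg hε.le]
        gcongr
        exact hB k hk)
  refine iSup₂_le fun t ht => ?_
  rw [← ofReal_norm]
  refine ENNReal.ofReal_le_ofReal ?_
  -- Between grid points each trajectory moves by at most `M ε`, which accounts for the term `2 M
  -- ε`.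
  have h1 := hy.norm_sub_floor_le hM hε one_pos hε1 ht.1
  have h2 := hw.norm_sub_floor_le hM hε ht.1
  have h3 := hgrid ⌊t / ε⌋₊ (Nat.floor_mono (by gcongr; exact ht.2))
  have h4 : Real.exp (L * (ε * ⌊t / ε⌋₊)) ≤ Real.exp (L * T₀) := by
    gcongr
    exact (mem_cell_floor hε ht.1).1.trans ht.2
  have h5 := mul_le_mul_of_nonneg_left h4 (a := 2 * L * M * T₀ * ε + ε * B) (by positivity)
  have h6 : errorTerm ν T F ε t x ω = (y t - y (ε * ⌊t / ε⌋₊)) - (w t - w (ε * ⌊t / ε⌋₊)) +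
      (y (ε * ⌊t / ε⌋₊) - w (ε * ⌊t / ε⌋₊)) := by
    rw [errorTerm]
    abel
  rw [h6]
  refine (norm_add_le _ _).trans ((add_le_add_left (norm_sub_le _ _) _).trans ?_)
  linarith

end Error

/-! ### The averaging estimate -/

section Field

variable {Ω : Type*} [MeasurableSpace Ω] {ν : Measure Ω} {T : Ω → Ω} {η r : ℝ} {d : ℕ}
  {F : (Fin d → ℝ) → Ω → (Fin d → ℝ)} {L M H : ℝ≥0}

/-- A coordinate of the centered field, divided by a bound of its size and Hölder constant. -/
noncomputable def centeredCoord (ν : Measure Ω) (F : (Fin d → ℝ) → Ω → (Fin d → ℝ))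
    (Λ : ℝ) (i : Fin d) (x : Fin d → ℝ) (ω : Ω) : ℝ :=
  (F x ω i - averagedField ν F x i) / Λ

theorem unitHolder_centeredCoord [MetricSpace Ω] [IsProbabilityMeasure ν] (hM : ∀ x ω, ‖F x ω‖ ≤ M)
    (hH : ∀ x ω ω', ‖F x ω - F x ω'‖ ≤ H * dist ω ω' ^ η) (i : Fin d) (x : Fin d → ℝ) :
    UnitHolder η 1 fun ω => (centeredCoord ν F (2 * M + H + 1) i x ω : ℂ) := by
  have hΛ : (0 : ℝ) < 2 * M + H + 1 := by positivity
  refine ⟨fun ω => ?_, fun ω ω' => ?_⟩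
  · rw [Complex.norm_real, centeredCoord, norm_div, Real.norm_of_nonneg hΛ.le, div_le_one hΛ]
    have h1 := (norm_le_pi_norm (F x ω) i).trans (hM x ω)
    have h2 := (norm_le_pi_norm (averagedField ν F x) i).trans (norm_averagedField_le hM x)
    have h3 := norm_sub_le (F x ω i) (averagedField ν F x i)
    have h4 : (0 : ℝ) ≤ H := H.2
    linarith
  · rw [← Complex.ofReal_sub, Complex.norm_real, centeredCoord, centeredCoord, ← sub_div,
      sub_sub_sub_cancel_right, norm_div, Real.norm_of_nonneg hΛ.le, div_le_iff₀ hΛ, one_mul]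
    have h1 := (norm_le_pi_norm (F x ω - F x ω') i).trans (hH x ω ω')
    rw [Pi.sub_apply] at h1
    refine h1.trans ?_
    rw [mul_comm]
    gcongr
    linarith [M.2]

theorem integral_centeredCoord [IsProbabilityMeasure ν] (hF : Measurable (Function.uncurry F))
    (hM : ∀ x ω, ‖F x ω‖ ≤ M) (Λ : ℝ) (i : Fin d) (x : Fin d → ℝ) :
    ∫ ω, centeredCoord ν F Λ i x ω ∂ν = 0 := by
  have hint : ∀ i, Integrable (fun ω => F x ω i) ν := (integrable_field hF hM x).eval
  simp only [centeredCoord]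
  rw [integral_div, integral_sub (hint i) (integrable_const _), averagedField, eval_integral hint]
  simp

/-- The moment bounds concern scalar observables, so the supremum norm on `ℝ^d` is bounded by a sum
over coordinates. -/
theorem norm_sum_sub_averagedField_le {Λ : ℝ} (hΛ : 0 < Λ) (z : ℕ → Fin d → ℝ) {m k : ℕ}
    (hk : k ≤ 2 ^ m) (ω : Ω) :
    ‖∑ j ∈ Finset.range k, (F (z j) (T^[j] ω) - averagedField ν F (z j))‖ ≤
      Λ * ∑ i, dyadicMax (fun j ω => centeredCoord ν F Λ i (z j) (T^[j] ω)) m 0 ω := by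
  have h0 : ∀ i, 0 ≤ dyadicMax (fun j ω => centeredCoord ν F Λ i (z j) (T^[j] ω)) m 0 ω :=
    fun i => dyadicMax_nonneg _ _ _ _
  refine (pi_norm_le_iff_of_nonneg (mul_nonneg hΛ.le (Finset.sum_nonneg fun i _ => h0 i))).2
    fun i => ?_
  have h1 := abs_sum_le_dyadicMax (fun j ω => centeredCoord ν F Λ i (z j) (T^[j] ω)) m 0 k hk ω
  have h2 := Finset.single_le_sum (fun i _ => h0 i) (Finset.mem_univ i)
  have h3 : (∑ j ∈ Finset.range k, (F (z j) (T^[j] ω) - averagedField ν F (z j))) i =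
      Λ * ∑ j ∈ Finset.range k, centeredCoord ν F Λ i (z (0 + j)) (T^[0 + j] ω) := by
    rw [Finset.sum_apply, Finset.mul_sum]
    refine Finset.sum_congr rfl fun j _ => ?_
    rw [zero_add, centeredCoord, mul_div_cancel₀ _ hΛ.ne', Pi.sub_apply]
  rw [h3, norm_mul, Real.norm_of_nonneg hΛ.le, Real.norm_eq_abs]
  gcongr
  exact h1.trans h2

/-- The averaging estimate in `L^(2q)`, for an integer `q ≥ 2`. -/
theorem MultipleDecorrelation.exists_eLpNorm_maxError_le [MetricSpace Ω] [BorelSpace Ω]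
    [IsProbabilityMeasure ν] (hP : MultipleDecorrelation ν T η r) (hT : MeasurePreserving T ν ν) (hη : 0 < η)
    (hr : 1 ≤ r) (hF : Measurable (Function.uncurry F))
    (hL : ∀ ω, LipschitzWith L fun x => F x ω) (hM : ∀ x ω, ‖F x ω‖ ≤ M)
    (hH : ∀ x ω ω', ‖F x ω - F x ω'‖ ≤ H * dist ω ω' ^ η) {T₀ : ℝ} (hT₀ : 0 < T₀)
    {q : ℕ} (hq : 2 ≤ q) :
    ∃ C : ℝ, ∀ ε : ℝ, 0 < ε → ε ≤ T₀ → ε ≤ 1 → ∀ x : Fin d → ℝ,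
      eLpNorm (maxError ν T F T₀ ε x) (ENNReal.ofReal (2 * q)) ν ≤ ENNReal.ofReal (C * √ε) := by
  obtain ⟨C₁, hC₁, hmom⟩ := hP.exists_eLpNorm_sum_le hT hη hr q (by omega)
  have hq4 : (4 : ℝ) ≤ 2 * q := by
    have : (2 : ℝ) ≤ q := by exact_mod_cast hq
    linarith
  set Λ : ℝ := 2 * M + H + 1 with hΛ_def
  have hΛ : 0 < Λ := by positivity
  set a : ℝ := 2 * M + 2 * L * M * T₀ * Real.exp (L * T₀) with ha
  set b : ℝ := Real.exp (L * T₀) * Λ with hb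
  have ha0 : 0 ≤ a := by positivity
  have hb0 : 0 ≤ b := by positivity
  -- Here `a` collects the discretization errors, `b` is the Gronwall factor times the normalization
  -- `Λ`, and `5 C₁` comes from the maximal inequality for each of the `d` coordinates.
  refine ⟨a + b * (d * (5 * C₁ * √(2 * T₀))), fun ε hε hεT hε1 x => ?_⟩
  set N := ⌊T₀ / ε⌋₊ with hN
  have hN0 : N ≠ 0 := (Nat.floor_pos.2 ((one_le_div hε).2 hεT)).ne'
  -- The dyadic length `2^m` lies between `N` and `2N`. The upper bound needs `N ≠ 0`, which is
  -- ensured by `ε ≤ T₀`.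
  set m := Nat.log 2 N + 1 with hm
  have hNm : N ≤ 2 ^ m := (Nat.lt_pow_succ_log_self one_lt_two N).le
  have hmN : 2 ^ m ≤ 2 * N := by
    rw [hm, pow_succ, mul_comm]
    exact Nat.mul_le_mul_left 2 (Nat.pow_log_le_self 2 hN0)
  set w := averagedSolution ν F x
  set X : Fin d → ℕ → Ω → ℝ := fun i j ω => centeredCoord ν F Λ i (w (ε * j)) (T^[j] ω)
  have hU : ∀ i (j : ℕ), UnitHolder η 1 fun ω => (centeredCoord ν F Λ i (w (ε * j)) ω : ℂ) :=
    fun i j => unitHolder_centeredCoord hM hH i _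
  have hXm : ∀ i j, Measurable (X i j) := fun i j =>
    ((hU i j).measurable_real hη).comp (hT.measurable.iterate j)
  have hD : ∀ i, eLpNorm (dyadicMax (X i) m 0) (ENNReal.ofReal (2 * q)) ν ≤
      ENNReal.ofReal (5 * C₁ * √(2 ^ m : ℕ)) := fun i =>
    eLpNorm_dyadicMax_le (hXm i) hq4 hC₁ (hmom (fun j => centeredCoord ν F Λ i (w (ε * j)))
      (hU i) fun j => integral_centeredCoord hF hM _ _ _) m 0
  have hDm : ∀ i, Measurable (dyadicMax (X i) m 0) := fun i => measurable_dyadicMax (hXm i) m 0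
  have hDs : Measurable (∑ i, dyadicMax (X i) m 0) := by
    rw [Finset.sum_fn]
    exact Finset.measurable_sum _ fun i _ => hDm i
  have h1q : (1 : ℝ≥0∞) ≤ ENNReal.ofReal (2 * q) := by
    rw [← ENNReal.ofReal_one]
    exact ENNReal.ofReal_le_ofReal (by linarith)
  have hpt : ∀ ω, ‖maxError ν T F T₀ ε x ω‖ₑ ≤
      ‖a * ε + (b * ε) • (∑ i, dyadicMax (X i) m 0) ω‖ₑ := fun ω => by
    have h := maxError_le hF hL hM hT₀ hε x ω fun k hk =>
      norm_sum_sub_averagedField_le (ν := ν) (F := F) (T := T) hΛ (fun j => w (ε * j))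
        (hk.trans hNm) ω
    rw [enorm_eq_self]
    refine h.trans (le_of_eq_of_le ?_ (ENNReal.ofReal_le_ofReal (le_abs_self _) |>.trans_eq
      (Real.enorm_eq_ofReal_abs _).symm))
    congr 1
    rw [Finset.sum_apply, smul_eq_mul, hb]
    ring
  refine (eLpNorm_mono_enorm hpt).trans ?_
  have hadd := eLpNorm_add_le (μ := ν) (p := ENNReal.ofReal (2 * q)) (f := fun _ : Ω => a * ε)
    (g := (b * ε) • ∑ i, dyadicMax (X i) m 0) aestronglyMeasurable_const
    (hDs.const_smul (b * ε)).aestronglyMeasurable h1q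
  have hconst : eLpNorm (fun _ : Ω => a * ε) (ENNReal.ofReal (2 * q)) ν ≤
      ENNReal.ofReal (a * ε) := by
    refine (eLpNorm_le_of_ae_bound (C := a * ε) (ae_of_all _ fun _ => ?_)).trans_eq (by simp)
    rw [Real.norm_of_nonneg (by positivity)]
  have hsum : eLpNorm (∑ i, dyadicMax (X i) m 0) (ENNReal.ofReal (2 * q)) ν ≤
      ENNReal.ofReal (d * (5 * C₁ * √(2 ^ m : ℕ))) := by
    refine (eLpNorm_sum_le (fun i _ => (hDm i).aestronglyMeasurable) h1q).trans ?_
    refine (Finset.sum_le_card_nsmul _ _ _ fun i _ => hD i).trans_eq ?_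
    rw [Finset.card_univ, Fintype.card_fin, ← ENNReal.ofReal_nsmul, nsmul_eq_mul]
  have hsmul : eLpNorm ((b * ε) • ∑ i, dyadicMax (X i) m 0) (ENNReal.ofReal (2 * q)) ν ≤
      ENNReal.ofReal (b * ε * (d * (5 * C₁ * √(2 ^ m : ℕ)))) := by
    rw [ENNReal.ofReal_mul (p := b * ε) (by positivity), eLpNorm_const_smul,
      Real.enorm_of_nonneg (by positivity)]
    exact mul_le_mul' le_rfl hsum
  refine (hadd.trans (add_le_add hconst hsmul)).trans ?_
  rw [← ENNReal.ofReal_add (by positivity) (by positivity)]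
  refine ENNReal.ofReal_le_ofReal ?_
  have hεs : ε ≤ √ε := Real.le_sqrt_of_sq_le (by nlinarith)
  -- The factor ε times a sum of order `√(T₀/ε)` has order `√ε`, by `2^m ε ≤ 2 N ε ≤ 2 T₀`.
  have hsqrt : ε * √(2 ^ m : ℕ) ≤ √(2 * T₀) * √ε := by
    have h2 : ((2 ^ m : ℕ) : ℝ) * ε ≤ 2 * T₀ := by
      have h3 : ((2 ^ m : ℕ) : ℝ) ≤ 2 * N := by exact_mod_cast hmN
      have h4 := (mem_cell_floor hε hT₀.le).1
      nlinarith
    calc ε * √(2 ^ m : ℕ) = √((2 ^ m : ℕ) * ε) * √ε := by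
          rw [Real.sqrt_mul (by positivity), mul_assoc, Real.mul_self_sqrt hε.le, mul_comm]
      _ ≤ _ := by gcongr
  calc a * ε + b * ε * (d * (5 * C₁ * √(2 ^ m : ℕ)))
      = a * ε + b * (d * (5 * C₁)) * (ε * √(2 ^ m : ℕ)) := by ring
    _ ≤ a * √ε + b * (d * (5 * C₁)) * (√(2 * T₀) * √ε) := by gcongr
    _ = _ := by ring

end Field

end Averaging

theorem propositionA1p6 {Ω : Type*} [MetricSpace Ω] [MeasurableSpace Ω] [BorelSpace Ω]
    (ν : Measure Ω) [IsProbabilityMeasure ν] (T : Ω → Ω) (hT : MeasurePreserving T ν ν)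
    (η : ℝ) (hη : η ∈ Set.Ioc (0 : ℝ) 1) (r₀ : ℝ) (hr₀ : 1 ≤ r₀)
    (hP : Averaging.MultipleDecorrelation ν T η r₀)
    {d : ℕ} (F : (Fin d → ℝ) → Ω → (Fin d → ℝ))
    (hFmeas : Measurable (Function.uncurry F))
    (hFbdd : ∃ M : ℝ, ∀ x ω, ‖F x ω‖ ≤ M)
    (hFlip : ∃ L : ℝ≥0, ∀ ω, LipschitzWith L fun x => F x ω)
    (hFholder : ∃ C : ℝ, ∀ x ω ω', ‖F x ω - F x ω'‖ ≤ C * dist ω ω' ^ η)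
    (T₀ : ℝ) (hT₀ : 0 < T₀) :
    (∀ ε : ℝ, 0 < ε → ∀ x, Measurable (Averaging.maxError ν T F T₀ ε x)) ∧
    ∀ p : ℝ, 1 ≤ p → ∃ C : ℝ, ∀ᶠ ε in 𝓝[>] (0 : ℝ),
      (⨆ x : Fin d → ℝ, eLpNorm (Averaging.maxError ν T F T₀ ε x) (ENNReal.ofReal (2 * p)) ν) ≤
        ENNReal.ofReal (C * √ε) := by
  obtain ⟨M, hM⟩ := hFbdd
  obtain ⟨L, hL⟩ := hFlip
  obtain ⟨H, hH⟩ := hFholder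
  replace hM : ∀ x ω, ‖F x ω‖ ≤ M.toNNReal := fun x ω => (hM x ω).trans (Real.le_coe_toNNReal M)
  replace hH : ∀ x ω ω', ‖F x ω - F x ω'‖ ≤ H.toNNReal * dist ω ω' ^ η := fun x ω ω' =>
    (hH x ω ω').trans (by gcongr; exact Real.le_coe_toNNReal H)
  have hmeas : ∀ ε : ℝ, 0 < ε → ∀ x, Measurable (Averaging.maxError ν T F T₀ ε x) :=
    fun ε hε x => Averaging.measurable_maxError hT.measurable hFmeas hL hM hT₀ hε x
  refine ⟨hmeas, fun p _ => ?_⟩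
  -- On a probability space the `L^{2p}` norm is at most the `L^{2q}` norm for an integer `q ≥ p`;
  -- the requirement `q ≥ 2` comes from the maximal inequality.
  obtain ⟨q, hq⟩ := exists_nat_ge p
  obtain ⟨C, hC⟩ := hP.exists_eLpNorm_maxError_le hT hη.1 hr₀ hFmeas hL hM hH hT₀
    (q := max q 2) (le_max_right _ _)
  refine ⟨C, ?_⟩
  filter_upwards [Ioc_mem_nhdsGT (lt_min hT₀ one_pos)] with ε hε
  refine iSup_le fun x => ?_
  refine (eLpNorm_le_eLpNorm_of_exponent_le (ENNReal.ofReal_le_ofReal ?_)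
    (hmeas ε hε.1 x).aestronglyMeasurable).trans
    (hC ε hε.1 (hε.2.trans (min_le_left _ _)) (hε.2.trans (min_le_right _ _)) x)
  have : (q : ℝ) ≤ (max q 2 : ℕ) := by exact_mod_cast le_max_left q 2
  linarith
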